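/- Let $\mathbb K$ be a field of characteristic zero and let $D_n=\mathbb K\langle x_1,\dots,x_n,\partial_1,\dots,\partial_n \mid \partial_i x_j = x_j\partial_i+\delta_{ij},\ x_ix_j=x_jx_i,\ \partial_i\partial_j=\partial_j\partial_i\rangle$ be the $n$-th Weyl algebra, i.e. the algebra of linear partial differential operators on $\mathbb K[x_1,\dots,x_n]$ with polynomial coefficients. Let $I\subset D_n$ be a left ideal such that the left $D_n$-module $D_n/I$ is holonomic, that is, it is zero or has dimension $n$: the Hilbert function of a good filtration of it with respect to the Bernstein filtration of $D_n$ is eventually a polynomial of degree $n$. Let $0\neq w\in\mathbb R^n_{\ge 0}$, where the weights $w_i$ lie in a subfield $F\subset\mathbb R$ that is embedded in $\mathbb K$ (so that $w_i$ is also an element of $\mathbb K$), and put $s:=\sum_{i=1}^n w_i x_i\partial_i\in D_n$. For $0\ne p=\sum_{\alpha,\beta} c_{\alpha\beta}x^\alpha\partial^\beta\in D_n$ let $m=\max\{-w\cdot\alpha+w\cdot\beta \mid c_{\alpha\beta}\neq 0\}$ and $\mathrm{in}_{(-w,w)}(p)=\sum_{-w\cdot\alpha+w\cdot\beta=m}c_{\alpha\beta}x^\alpha\partial^\beta$;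 put $\mathrm{in}_{(-w,w)}(0)=0$. Let $\mathrm{in}_{(-w,w)}(I)$ be the $\mathbb K$-span of $\{\mathrm{in}_{(-w,w)}(p)\mid p\in I\}$. The intersection $\mathrm{in}_{(-w,w)}(I)\cap\mathbb K[s]$ is a principal ideal of $\mathbb K[s]$; its monic generator ($0$ if the intersection is zero), regarded as a univariate polynomial $b_{I,w}$, is the global $b$-function of $I$ with respect to $w$. Then $\mathrm{in}_{(-w,w)}(I)\cap \mathbb K[s]\neq \{0\}$, that is, the global $b$-function $b_{I,w}$ is nonzero. -/

import Mathlib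

open scoped Polynomial

noncomputable section

namespace DMod

section Weyl

variable (K : Type*) [Field K] (n : ℕ)

/-- The `n`-th Weyl algebra: the `K`-algebra of linear partial differential operators with
polynomial coefficients, generated inside `End_K(K[x_1, …, x_n])` by the multiplications by the
variables and the partial derivatives. -/
def weylAlgebra : Subalgebra K (Module.End K (MvPolynomial (Fin n) K)) :=
  Algebra.adjoin K
    (Set.range (fun i : Fin n => LinearMap.mulLeft K (MvPolynomial.X i : MvPolynomial (Fin n) K)) ∪
     Set.range (fun i : Fin n => (MvPolynomial.pderiv i : Derivation K (MvPolynomial (Fin n) K)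
        (MvPolynomial (Fin n) K)).toLinearMap))

/-- The Weyl algebra `D_n` as a ring. -/
def D : Type _ := ↥(weylAlgebra K n)

instance instRingD : Ring (D K n) := inferInstanceAs (Ring ↥(weylAlgebra K n))

instance instAlgebraD : Algebra K (D K n) := inferInstanceAs (Algebra K ↥(weylAlgebra K n))

variable {n}

/-- The generator `x_i`, acting as multiplication by the `i`-th variable. -/
def x (i : Fin n) : D K n :=
  ⟨LinearMap.mulLeft K (MvPolynomial.X i), Algebra.subset_adjoin (Or.inl ⟨i, rfl⟩)⟩

/-- The generator `∂_i`, acting as the `i`-th partial derivative. -/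
def dd (i : Fin n) : D K n :=
  ⟨(MvPolynomial.pderiv i : Derivation K (MvPolynomial (Fin n) K)
        (MvPolynomial (Fin n) K)).toLinearMap, Algebra.subset_adjoin (Or.inr ⟨i, rfl⟩)⟩

variable {K}

/-- An operator lying in the Weyl algebra, as an element of `D_n`. -/
def ofMem (p : Module.End K (MvPolynomial (Fin n) K)) (hp : p ∈ weylAlgebra K n) : D K n :=
  ⟨p, hp⟩

theorem D_ext {p q : D K n} (h : ∀ (γ : Fin n →₀ ℕ),
    p.1 (MvPolynomial.monomial γ 1) = q.1 (MvPolynomial.monomial γ 1)) : p = q := by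
  apply Subtype.ext
  exact (MvPolynomial.basisMonomials (Fin n) K).ext (fun γ => by simpa using h γ)

theorem x_apply (i : Fin n) (f : MvPolynomial (Fin n) K) :
    (x K i).1 f = MvPolynomial.X i * f := rfl

theorem dd_apply (i : Fin n) (f : MvPolynomial (Fin n) K) :
    (dd K i).1 f = MvPolynomial.pderiv i f := rfl

theorem x_comm (i j : Fin n) : Commute (x K i) (x K j) := by
  apply Subtype.ext
  refine LinearMap.ext fun f => ?_
  change MvPolynomial.X i * (MvPolynomial.X j * f) = MvPolynomial.X j * (MvPolynomial.X i * f)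
  ring

theorem dd_comm (i j : Fin n) : Commute (dd K i) (dd K j) := by
  apply D_ext
  intro γ
  change MvPolynomial.pderiv i (MvPolynomial.pderiv j _)
    = MvPolynomial.pderiv j (MvPolynomial.pderiv i _)
  by_cases h : i = j
  · rw [h]
  · simp only [MvPolynomial.pderiv_monomial, Finsupp.tsub_apply, Finsupp.single_apply, h,
      Ne.symm h, if_false, tsub_zero, tsub_tsub, add_comm (Finsupp.single i 1)]
    congr 1
    ring

theorem dd_mul_x (i j : Fin n) :
    dd K i * x K j = x K j * dd K i + (if i = j then 1 else 0) := by
  apply Subtype.ext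
  refine LinearMap.ext fun f => ?_
  have h1 : (dd K i * x K j).1 f = MvPolynomial.pderiv i (MvPolynomial.X j * f) := rfl
  have h2 : (x K j * dd K i + (if i = j then 1 else 0)).1 f
      = MvPolynomial.X j * MvPolynomial.pderiv i f + (if i = j then f else 0) := by
    split_ifs <;> rfl
  rw [h1, h2, MvPolynomial.pderiv_mul, MvPolynomial.pderiv_X]
  by_cases h : i = j
  · subst h; simp; ring
  · simp [h, Ne.symm h]

variable (K)

theorem xPow_comm (α : Fin n →₀ ℕ) :
    ((Finset.univ : Finset (Fin n)) : Set (Fin n)).Pairwise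
      (Function.onFun Commute fun i => x K i ^ α i) :=
  fun i _ j _ _ => (x_comm i j).pow_pow (α i) (α j)

theorem ddPow_comm (β : Fin n →₀ ℕ) :
    ((Finset.univ : Finset (Fin n)) : Set (Fin n)).Pairwise
      (Function.onFun Commute fun i => dd K i ^ β i) :=
  fun i _ j _ _ => (dd_comm i j).pow_pow (β i) (β j)

/-- The power product `x^α = ∏ i, x_i ^ α_i`. -/
def xPow (α : Fin n →₀ ℕ) : D K n :=
  Finset.univ.noncommProd (fun i => x K i ^ α i)
    (xPow_comm K α)

/-- The power product `∂^β = ∏ i, ∂_i ^ β_i`. -/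
def ddPow (β : Fin n →₀ ℕ) : D K n :=
  Finset.univ.noncommProd (fun i => dd K i ^ β i)
    (ddPow_comm K β)

/-- The monomial `x^α ∂^β` for `ab = (α, β)`. -/
def mono (ab : (Fin n →₀ ℕ) × (Fin n →₀ ℕ)) : D K n := xPow K ab.1 * ddPow K ab.2

variable {K}

theorem xPow_add (α β : Fin n →₀ ℕ) : xPow K (α + β) = xPow K α * xPow K β := by
  refine Eq.trans ?_ (Finset.noncommProd_mul_distrib (s := Finset.univ) (fun i => x K i ^ α i)
    (fun i => x K i ^ β i) (xPow_comm K α) (xPow_comm K β)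
    (fun i _ j _ _ => (x_comm i j).pow_pow _ _))
  exact Finset.noncommProd_congr rfl (fun i _ => by simp [pow_add]) _

theorem ddPow_add (α β : Fin n →₀ ℕ) : ddPow K (α + β) = ddPow K α * ddPow K β := by
  refine Eq.trans ?_ (Finset.noncommProd_mul_distrib (s := Finset.univ) (fun i => dd K i ^ α i)
    (fun i => dd K i ^ β i) (ddPow_comm K α) (ddPow_comm K β)
    (fun i _ j _ _ => (dd_comm i j).pow_pow _ _))
  exact Finset.noncommProd_congr rfl (fun i _ => by simp [pow_add]) _

theorem noncommProd_single {M : Type*} [Monoid M] (f : Fin n → M) (i : Fin n) (k : ℕ)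
    (comm) : Finset.univ.noncommProd (fun j => f j ^ (Finsupp.single i k j)) comm = f i ^ k := by
  classical
  have hu : (Finset.univ : Finset (Fin n)) = insert i (Finset.univ.erase i) := by simp
  refine (Finset.noncommProd_congr hu (fun _ _ => rfl) comm).trans
    ((Finset.noncommProd_insert_of_notMem _ _ _ _ (by simp)).trans ?_)
  refine (congrArg _ (Finset.noncommProd_eq_pow_card _ _ _ 1 ?_)).trans ?_
  · intro j hj
    have : i ≠ j := by
      rintro rfl
      simp at hj
    simp [this]
  · simp

theorem xPow_single (i : Fin n) (k : ℕ) : xPow K (Finsupp.single i k) = x K i ^ k :=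
  noncommProd_single _ _ _ _

theorem ddPow_single (i : Fin n) (k : ℕ) : ddPow K (Finsupp.single i k) = dd K i ^ k :=
  noncommProd_single _ _ _ _

theorem xPow_zero : xPow K (0 : Fin n →₀ ℕ) = 1 := by
  exact (Finset.noncommProd_eq_pow_card _ _ (xPow_comm K 0) 1 (by simp)).trans (one_pow _)

theorem ddPow_zero : ddPow K (0 : Fin n →₀ ℕ) = 1 := by
  exact (Finset.noncommProd_eq_pow_card _ _ (ddPow_comm K 0) 1 (by simp)).trans (one_pow _)

theorem xPow_apply (α : Fin n →₀ ℕ) : ∀ f : MvPolynomial (Fin n) K,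
    (xPow K α).1 f = MvPolynomial.monomial α 1 * f := by
  induction α using Finsupp.induction_linear with
  | zero =>
    intro f
    rw [xPow_zero]
    change f = _
    simp
  | add a b ha hb =>
    intro f
    rw [xPow_add]
    change (xPow K a).1 ((xPow K b).1 f) = _
    rw [hb, ha, ← mul_assoc, MvPolynomial.monomial_mul, one_mul]
  | single i k =>
    rw [xPow_single]
    induction k with
    | zero => intro f; change f = _; simp
    | succ k ih =>
      intro f
      rw [pow_succ]
      change (x K i ^ k).1 ((x K i).1 f) = _
      rw [ih, x_apply, ← mul_assoc, MvPolynomial.X, MvPolynomial.monomial_mul, one_mul,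
        ← Finsupp.single_add]

theorem ddPow_apply [CharZero K] (β : Fin n →₀ ℕ) : ∀ γ : Fin n →₀ ℕ, ∃ k : K, (k ≠ 0 ↔ β ≤ γ) ∧
    (ddPow K β).1 (MvPolynomial.monomial γ 1) = MvPolynomial.monomial (γ - β) k := by
  induction β using Finsupp.induction_linear with
  | zero =>
    intro γ
    refine ⟨1, by simp, ?_⟩
    rw [ddPow_zero, tsub_zero]
    rfl
  | add a b ha hb =>
    intro γ
    obtain ⟨k, hk, hk'⟩ := hb γ
    obtain ⟨l, hl, hl'⟩ := ha (γ - b)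
    refine ⟨k * l, ?_, ?_⟩
    · rw [mul_ne_zero_iff, hk, hl]
      constructor
      · rintro ⟨h1, h2⟩
        exact (le_tsub_iff_right h1).1 h2
      · intro h
        have h1 : b ≤ γ := le_trans le_add_self h
        exact ⟨h1, (le_tsub_iff_right h1).2 h⟩
    · rw [ddPow_add]
      change (ddPow K a).1 ((ddPow K b).1 _) = _
      have : (MvPolynomial.monomial (γ - b) k : MvPolynomial (Fin n) K)
          = k • MvPolynomial.monomial (γ - b) 1 := by simp [MvPolynomial.smul_monomial]
      rw [hk', this, map_smul, hl', MvPolynomial.smul_monomial, tsub_tsub, add_comm b a,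
        smul_eq_mul]
  | single i m =>
    intro γ
    refine ⟨((γ i).descFactorial m : K), ?_, ?_⟩
    · rw [Nat.cast_ne_zero, Ne, Nat.descFactorial_eq_zero_iff_lt, not_lt, Finsupp.single_le_iff]
    · rw [ddPow_single]
      induction m with
      | zero =>
        rw [pow_zero, Finsupp.single_zero, tsub_zero, Nat.descFactorial_zero, Nat.cast_one]
        rfl
      | succ m ih =>
        rw [pow_succ']
        change (dd K i).1 ((dd K i ^ m).1 _) = _
        rw [ih, dd_apply, MvPolynomial.pderiv_monomial, tsub_tsub, ← Finsupp.single_add,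
          Nat.descFactorial_succ]
        congr 1
        simp [mul_comm]

theorem linearIndependent_mono [CharZero K] :
    LinearIndependent K (mono K : (Fin n →₀ ℕ) × (Fin n →₀ ℕ) → D K n) := by
  classical
  apply LinearIndependent.of_comp (weylAlgebra K n).val.toLinearMap
  rw [linearIndependent_iff]
  intro c hc
  by_contra hne
  obtain ⟨⟨α₀, β₀⟩, h₀, hmin⟩ := c.support.exists_min_image (fun ab => ab.2.degree)
    (Finsupp.support_nonempty_iff.2 hne)
  have h1 := LinearMap.congr_fun hc (MvPolynomial.monomial β₀ 1)
  obtain ⟨k, hk, hk'⟩ := ddPow_apply (K := K) β₀ β₀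
  have h2 : (Finsupp.linearCombination K ((weylAlgebra K n).val.toLinearMap ∘ mono K)) c
        (MvPolynomial.monomial β₀ 1)
      = ∑ ab ∈ c.support, c ab • (mono K ab).1 (MvPolynomial.monomial β₀ 1) := by
    rw [Finsupp.linearCombination_apply, Finsupp.sum, LinearMap.sum_apply]
    rfl
  have h3 : ∀ ab ∈ c.support, (c ab • (mono K ab).1 (MvPolynomial.monomial β₀ 1)).coeff α₀
      = if ab = (α₀, β₀) then c (α₀, β₀) * k else 0 := by
    rintro ⟨α, β⟩ hab
    have h4 : (mono K (α, β)).1 (MvPolynomial.monomial β₀ 1)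
      = (xPow K α).1 ((ddPow K β).1 (MvPolynomial.monomial β₀ 1)) := rfl
    obtain ⟨l, hl, hl'⟩ := ddPow_apply (K := K) β β₀
    by_cases hβ : β = β₀
    · subst hβ
      rw [h4, hk', xPow_apply, MvPolynomial.monomial_mul, MvPolynomial.coeff_smul,
        MvPolynomial.coeff_monomial]
      by_cases hα : α = α₀
      · subst hα; simp
      · simp [hα]
    · have hn : ¬ β ≤ β₀ := by
        intro hle
        apply hβ
        have h5 := hmin _ hab
        obtain ⟨δ, rfl⟩ := exists_add_of_le hle
        simp only [map_add] at h5
        have h6 : δ.degree = 0 := by omega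
        rw [Finsupp.degree_eq_zero_iff] at h6
        simp [h6]
      have hl0 : l = 0 := by
        by_contra h
        exact hn (hl.1 h)
      rw [h4, hl', hl0]
      simp [hβ]
  rw [h2] at h1
  have h7 := congrArg (MvPolynomial.coeff α₀) h1
  rw [MvPolynomial.coeff_sum, Finset.sum_congr rfl h3, Finset.sum_ite_eq' ] at h7
  simp only [h₀, if_true, MvPolynomial.coeff_zero, LinearMap.zero_apply, mul_eq_zero] at h7
  rcases h7 with h7 | h7
  · exact (Finsupp.mem_support_iff.1 h₀) h7
  · exact (hk.2 le_rfl) h7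

theorem x_mul_mono (i : Fin n) (α β : Fin n →₀ ℕ) :
    x K i * mono K (α, β) = mono K (Finsupp.single i 1 + α, β) := by
  simp only [mono]
  rw [xPow_add, xPow_single, pow_one, mul_assoc]

theorem dd_mul_mono (i : Fin n) (α β : Fin n →₀ ℕ) :
    dd K i * mono K (α, β) = mono K (α, Finsupp.single i 1 + β)
      + (α i : K) • mono K (α - Finsupp.single i 1, β) := by
  have h : dd K i * xPow K α = xPow K α * dd K i
      + (α i : K) • xPow K (α - Finsupp.single i 1) := by
    apply Subtype.ext
    refine LinearMap.ext fun f => ?_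
    change MvPolynomial.pderiv i ((xPow K α).1 f) = (xPow K α).1 (MvPolynomial.pderiv i f)
      + (α i : K) • (xPow K (α - Finsupp.single i 1)).1 f
    simp only [xPow_apply, MvPolynomial.pderiv_mul, MvPolynomial.pderiv_monomial, one_mul]
    rw [add_comm, ← smul_mul_assoc, MvPolynomial.smul_monomial, smul_eq_mul, mul_one]
  simp only [mono]
  rw [← mul_assoc, h, add_mul, smul_mul_assoc, mul_assoc, ddPow_add, ddPow_single, pow_one]

theorem span_mono :
    Submodule.span K (Set.range (mono K : (Fin n →₀ ℕ) × (Fin n →₀ ℕ) → D K n)) = ⊤ := by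
  set V := Submodule.span K (Set.range (mono K : (Fin n →₀ ℕ) × (Fin n →₀ ℕ) → D K n)) with hV
  have hx : ∀ i, ∀ v ∈ V, x K i * v ∈ V := by
    intro i v hv
    induction hv using Submodule.span_induction with
    | mem y hy =>
      obtain ⟨⟨α, β⟩, rfl⟩ := hy
      rw [x_mul_mono]
      exact Submodule.subset_span ⟨_, rfl⟩
    | zero => simp
    | add y z _ _ hy hz => rw [mul_add]; exact V.add_mem hy hz
    | smul k y _ hy => rw [mul_smul_comm]; exact V.smul_mem k hy
  have hd : ∀ i, ∀ v ∈ V, dd K i * v ∈ V := by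
    intro i v hv
    induction hv using Submodule.span_induction with
    | mem y hy =>
      obtain ⟨⟨α, β⟩, rfl⟩ := hy
      rw [dd_mul_mono]
      exact V.add_mem (Submodule.subset_span ⟨_, rfl⟩)
        (V.smul_mem _ (Submodule.subset_span ⟨_, rfl⟩))
    | zero => simp
    | add y z _ _ hy hz => rw [mul_add]; exact V.add_mem hy hz
    | smul k y _ hy => rw [mul_smul_comm]; exact V.smul_mem k hy
  have h1 : (1 : D K n) ∈ V :=
    Submodule.subset_span ⟨(0, 0), by simp [mono, xPow_zero, ddPow_zero]⟩
  have key : ∀ (p : Module.End K (MvPolynomial (Fin n) K)) (hp : p ∈ weylAlgebra K n),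
      ∀ v ∈ V, ofMem p hp * v ∈ V := by
    intro p hp
    induction hp using Algebra.adjoin_induction with
    | mem y hy =>
      rcases hy with ⟨i, rfl⟩ | ⟨i, rfl⟩
      · exact hx i
      · exact hd i
    | algebraMap r =>
      intro v hv
      have : ofMem (algebraMap K _ r) ((weylAlgebra K n).algebraMap_mem r) * v = r • v := by
        rw [Algebra.smul_def]; rfl
      rw [this]
      exact V.smul_mem r hv
    | add y z hy hz h1 h2 =>
      intro v hv
      have : ofMem (y + z) (add_mem hy hz) * v = ofMem y hy * v
        + ofMem z hz * v := by rw [← add_mul]; rfl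
      rw [this]
      exact V.add_mem (h1 v hv) (h2 v hv)
    | mul y z hy hz h1 h2 =>
      intro v hv
      have : ofMem (y * z) (mul_mem hy hz) * v = ofMem y hy
        * (ofMem z hz * v) := by rw [← mul_assoc]; rfl
      rw [this]
      exact h1 _ (h2 v hv)
  rw [eq_top_iff]
  intro q _
  obtain ⟨p, hp⟩ := q
  have := key p hp 1 h1
  rwa [mul_one] at this

variable (K n) in
/-- The `K`-basis `x^α ∂^β` of the Weyl algebra (in characteristic zero). Its coordinates are the
coefficients `c_{αβ}` in `p = ∑ c_{αβ} x^α ∂^β`. -/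
def monoBasis [CharZero K] : Module.Basis ((Fin n →₀ ℕ) × (Fin n →₀ ℕ)) K (D K n) :=
  Module.Basis.mk linearIndependent_mono (le_of_eq span_mono.symm)

theorem monoBasis_apply [CharZero K] (ab : (Fin n →₀ ℕ) × (Fin n →₀ ℕ)) :
    monoBasis K n ab = mono K ab := by
  simp [monoBasis]

end Weyl

section Holonomic

variable (K : Type*) [Field K] (n : ℕ)

/-- The `k`-th step of the Bernstein filtration: the `K`-span of all `x^α ∂^β` with
`|α| + |β| ≤ k`. -/
def bernstein (k : ℕ) : Submodule K (D K n) :=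
  Submodule.span K (mono K '' {ab | ab.1.degree + ab.2.degree ≤ k})

/-- The `k`-th step of the good filtration of a left `D_n`-module `M` that is induced by a finite
set `S` of generators and the Bernstein filtration: the `K`-span of all `P • v` with `P` in
the `k`-th step of the Bernstein filtration and `v ∈ S`. -/
def inducedFiltration {M : Type*} [AddCommGroup M] [Module K M] [Module (D K n) M]
    (S : Finset M) (k : ℕ) : Submodule K M :=
  Submodule.span K {m | ∃ P ∈ bernstein K n k, ∃ v ∈ S, m = P • v}

/-- A left `D_n`-module is holonomic if it is zero, or finitely generated of dimension `n`: the
Hilbert function `k ↦ dim_K F_k` of the good filtration `F` induced by a finite set of generators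
agrees for large `k` with a polynomial of degree `n`. (The degree of this polynomial does not
depend on the generators.) -/
def IsHolonomic (M : Type*) [AddCommGroup M] [Module K M] [Module (D K n) M]
    [IsScalarTower K (D K n) M] : Prop :=
  Subsingleton M ∨
    ∃ S : Finset M, Submodule.span (D K n) (S : Set M) = ⊤ ∧
      ∃ χ : ℚ[X], χ.natDegree = n ∧
        ∀ᶠ k : ℕ in Filter.atTop,
          (Module.finrank K (inducedFiltration K n S k) : ℚ) = χ.eval (k : ℚ)

end Holonomic

section Initial

variable {K : Type*} [Field K] [CharZero K] {n : ℕ}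

/-- The `(-w, w)`-weight `-w·α + w·β` of the monomial `x^α ∂^β`. -/
def weight (w : Fin n → ℝ) (ab : (Fin n →₀ ℕ) × (Fin n →₀ ℕ)) : ℝ :=
  -(∑ i, w i * ab.1 i) + ∑ i, w i * ab.2 i

open Classical in
/-- The initial form `in_{(-w,w)}(p)`: the sum of the terms `c_{αβ} x^α ∂^β` of `p` whose weight is
the maximum of the weights of the terms with nonzero coefficient; `in_{(-w,w)}(0) = 0`. -/
def initialForm (w : Fin n → ℝ) (p : D K n) : D K n :=
  ∑ ab ∈ ((monoBasis K n).repr p).support with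
      IsGreatest (weight w '' ((monoBasis K n).repr p).support) (weight w ab),
    (monoBasis K n).repr p ab • mono K ab

/-- The initial ideal `in_{(-w,w)}(I)`, the `K`-span of the initial forms of the elements
of the left ideal `I`. -/
def initialIdeal (w : Fin n → ℝ) (I : Ideal (D K n)) : Submodule K (D K n) :=
  Submodule.span K (initialForm w '' (I : Set (D K n)))

/-- The element `s = ∑ i, c_i x_i ∂_i` of the Weyl algebra. -/
def euler (c : Fin n → K) : D K n := ∑ i, c i • (x K i * dd K i)

/-- The span of all `x^α ∂^β` with weight in `T`. -/
def weightSpan (w : Fin n → ℝ) (T : Set ℝ) : Submodule K (D K n) :=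
  Submodule.span K (mono K '' {ab | weight w ab ∈ T})

theorem mem_weightSpan (w : Fin n → ℝ) (T : Set ℝ) (p : D K n) :
    p ∈ weightSpan w T ↔ ∀ ab ∈ ((monoBasis K n).repr p).support, weight w ab ∈ T := by
  have h : (mono K : (Fin n →₀ ℕ) × (Fin n →₀ ℕ) → D K n) = monoBasis K n :=
    funext fun ab => (monoBasis_apply ab).symm
  rw [weightSpan, h, Module.Basis.mem_span_image]
  rfl

theorem euler_mul_mem (w : Fin n → ℝ) (T : Set ℝ) (c : Fin n → K) {p : D K n}
    (hp : p ∈ weightSpan w T) : euler c * p ∈ weightSpan w T := by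
  induction hp using Submodule.span_induction with
  | zero => simp
  | add y z _ _ hy hz => rw [mul_add]; exact Submodule.add_mem _ hy hz
  | smul k y _ hy => rw [mul_smul_comm]; exact Submodule.smul_mem _ k hy
  | mem y hy =>
    obtain ⟨⟨α, β⟩, hab, rfl⟩ := hy
    rw [euler, Finset.sum_mul]
    refine Submodule.sum_mem _ fun i _ => ?_
    rw [smul_mul_assoc, mul_assoc, dd_mul_mono, mul_add, x_mul_mono, mul_smul_comm, x_mul_mono]
    refine Submodule.smul_mem _ _ (Submodule.add_mem _ (Submodule.subset_span ⟨_, ?_, rfl⟩) ?_)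
    · have : weight w (Finsupp.single i 1 + α, Finsupp.single i 1 + β) = weight w (α, β) := by
        simp [weight, mul_add, Finset.sum_add_distrib]
      change weight w _ ∈ T
      rw [this]
      exact hab
    · by_cases h : α i = 0
      · simp [h]
      · have h1 : Finsupp.single i 1 ≤ α := by
          rw [Finsupp.single_le_iff]
          omega
        rw [add_tsub_cancel_of_le h1]
        exact Submodule.smul_mem _ _ (Submodule.subset_span ⟨_, hab, rfl⟩)

theorem initialForm_zero (w : Fin n → ℝ) : initialForm w (0 : D K n) = 0 := by
  simp [initialForm]

theorem initialForm_add (w : Fin n → ℝ) (m : ℝ) {a b : D K n} (ha : a ∈ weightSpan w {m})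
    (hb : b ∈ weightSpan w (Set.Iio m)) (ha0 : a ≠ 0) : initialForm w (a + b) = a := by
  classical
  rw [mem_weightSpan] at ha hb
  set f := (monoBasis K n).repr a with hf
  set g := (monoBasis K n).repr b with hg
  have hfg : (monoBasis K n).repr (a + b) = f + g := map_add _ _ _
  have hfa : ∀ ab, weight w ab = m → (f + g) ab = f ab := by
    intro ab h
    have : g ab = 0 := by
      by_contra h1
      have := hb ab (Finsupp.mem_support_iff.2 h1)
      rw [h] at this
      exact lt_irrefl m this
    rw [Finsupp.add_apply, this, add_zero]
  have hle : ∀ ab ∈ (f + g).support, weight w ab ≤ m := by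
    intro ab hab
    rcases Finset.mem_union.1 (Finsupp.support_add hab) with h | h
    · exact le_of_eq (ha ab h)
    · exact le_of_lt (hb ab h)
  have hf0 : f ≠ 0 := by
    rw [hf]
    simpa using ha0
  obtain ⟨ab₀, h₀⟩ := Finsupp.support_nonempty_iff.2 hf0
  have h₀' : ab₀ ∈ (f + g).support := by
    rw [Finsupp.mem_support_iff, hfa _ (ha _ h₀)]
    exact Finsupp.mem_support_iff.1 h₀
  have hm : IsGreatest (weight w '' ((f + g).support : Set _)) m :=
    ⟨⟨ab₀, h₀', ha _ h₀⟩, by rintro _ ⟨ab, hab, rfl⟩; exact hle ab hab⟩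
  have hfil : (f + g).support.filter (fun ab =>
      IsGreatest (weight w '' ((f + g).support : Set _)) (weight w ab)) = f.support := by
    ext ab
    rw [Finset.mem_filter]
    constructor
    · rintro ⟨h1, h2⟩
      have h3 : weight w ab = m := h2.unique hm
      rw [Finsupp.mem_support_iff, ← hfa _ h3]
      exact Finsupp.mem_support_iff.1 h1
    · intro h
      have h3 : weight w ab = m := ha _ h
      refine ⟨?_, by rw [h3]; exact hm⟩
      rw [Finsupp.mem_support_iff, hfa _ h3]
      exact Finsupp.mem_support_iff.1 h
  have hsum : a = ∑ ab ∈ f.support, f ab • mono K ab := by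
    conv_lhs => rw [← (monoBasis K n).linearCombination_repr a]
    rw [Finsupp.linearCombination_apply, Finsupp.sum]
    exact Finset.sum_congr rfl fun ab _ => by rw [monoBasis_apply]
  rw [initialForm, hfg]
  conv_rhs => rw [hsum]
  refine Finset.sum_congr ?_ ?_
  · rw [← hfil]
  · intro ab hab
    rw [hfa _ (ha _ hab)]

theorem exists_decomp (w : Fin n → ℝ) (p : D K n) (hp : p ≠ 0) :
    ∃ m : ℝ, ∃ a ∈ weightSpan w {m}, ∃ b ∈ weightSpan w (Set.Iio m), a ≠ 0 ∧ p = a + b := by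
  classical
  set f := (monoBasis K n).repr p with hf
  have hf0 : f ≠ 0 := by
    rw [hf]
    simpa using hp
  obtain ⟨ab₀, h₀, hmax⟩ := f.support.exists_max_image (weight w)
    (Finsupp.support_nonempty_iff.2 hf0)
  refine ⟨weight w ab₀, (monoBasis K n).repr.symm (f.filter fun ab => weight w ab = weight w ab₀),
    ?_, (monoBasis K n).repr.symm (f.filter fun ab => ¬ weight w ab = weight w ab₀), ?_, ?_, ?_⟩
  · rw [mem_weightSpan]
    intro ab hab
    simp only [LinearEquiv.apply_symm_apply, Finsupp.support_filter, Finset.mem_filter] at hab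
    exact hab.2
  · rw [mem_weightSpan]
    intro ab hab
    simp only [LinearEquiv.apply_symm_apply, Finsupp.support_filter, Finset.mem_filter] at hab
    exact lt_of_le_of_ne (hmax ab hab.1) hab.2
  · intro h
    have h1 := congrArg (fun q => (monoBasis K n).repr q ab₀) h
    simp only [LinearEquiv.apply_symm_apply, map_zero, Finsupp.coe_zero, Pi.zero_apply,
      Finsupp.filter_apply_pos (fun ab => weight w ab = weight w ab₀) f rfl] at h1
    exact (Finsupp.mem_support_iff.1 h₀) h1
  · rw [← map_add, Finsupp.filter_add_filter_not, hf, LinearEquiv.symm_apply_apply]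

theorem euler_mul_mem_initialIdeal (w : Fin n → ℝ) (c : Fin n → K) (I : Ideal (D K n))
    {p : D K n} (hp : p ∈ initialIdeal w I) : euler c * p ∈ initialIdeal w I := by
  induction hp using Submodule.span_induction with
  | zero => simp
  | add y z _ _ hy hz => rw [mul_add]; exact Submodule.add_mem _ hy hz
  | smul k y _ hy => rw [mul_smul_comm]; exact Submodule.smul_mem _ k hy
  | mem y hy =>
    obtain ⟨q, hq, rfl⟩ := hy
    by_cases hq0 : q = 0
    · rw [hq0, initialForm_zero, mul_zero]
      exact Submodule.zero_mem _
    obtain ⟨m, a, ha, b, hb, ha0, rfl⟩ := exists_decomp w q hq0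
    rw [initialForm_add w m ha hb ha0]
    by_cases h0 : euler c * a = 0
    · rw [h0]
      exact Submodule.zero_mem _
    · rw [← initialForm_add w m (euler_mul_mem w _ c ha) (euler_mul_mem w _ c hb) h0, ← mul_add]
      exact Submodule.subset_span ⟨_, I.mul_mem_left _ hq, rfl⟩

/-- The ideal of `K[X]` corresponding to `in_{(-w,w)}(I) ∩ K[s]` under `X ↦ s = ∑ c_i x_i ∂_i`. -/
def bIdeal (w : Fin n → ℝ) (c : Fin n → K) (I : Ideal (D K n)) : Ideal K[X] where
  carrier := {q | Polynomial.aeval (euler c) q ∈ initialIdeal w I}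
  add_mem' {a b} ha hb := by
    simp only [Set.mem_ofPred_eq, map_add] at *
    exact Submodule.add_mem _ ha hb
  zero_mem' := by simp
  smul_mem' q b hb := by
    simp only [Set.mem_ofPred_eq, smul_eq_mul, map_mul] at *
    generalize Polynomial.aeval (euler c) b = p at hb
    induction q using Polynomial.induction_on' with
    | add q r hq hr =>
      rw [map_add, add_mul]
      exact Submodule.add_mem _ hq hr
    | monomial k r =>
      rw [Polynomial.aeval_monomial, mul_assoc, ← Algebra.smul_def]
      refine Submodule.smul_mem _ _ ?_
      induction k with
      | zero => simpa using hb
      | succ k ih =>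
        rw [pow_succ', mul_assoc]
        exact euler_mul_mem_initialIdeal w c I ih

/-- For a weight vector `w` with entries in a subfield `F` of `ℝ` over which `K` is an algebra,
the element `s = ∑ i, w_i x_i ∂_i` of `D_n`. -/
def sOp (K : Type*) [Field K] [CharZero K] {F : Subfield ℝ} [Algebra F K] (w : Fin n → F) :
    D K n :=
  euler fun i => algebraMap F K (w i)

/-- The global `b`-function of `I` with respect to the weight `w`: the monic generator (or `0`)
of the ideal `in_{(-w,w)}(I) ∩ K[s]` of `K[s]`, where `s = ∑ i, w_i x_i ∂_i`. -/
def globalBFunction {F : Subfield ℝ} [Algebra F K] (w : Fin n → F) (I : Ideal (D K n)) : K[X] :=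
  let g := Submodule.IsPrincipal.generator
    (bIdeal (fun i => (w i : ℝ)) (fun i => algebraMap F K (w i)) I)
  g * Polynomial.C g.leadingCoeff⁻¹

theorem globalBFunction_dvd_iff {F : Subfield ℝ} [Algebra F K] (w : Fin n → F)
    (I : Ideal (D K n)) (q : K[X]) :
    globalBFunction w I ∣ q ↔
      Polynomial.aeval (sOp K w) q ∈ initialIdeal (fun i => (w i : ℝ)) I := by
  set B := bIdeal (fun i => (w i : ℝ)) (fun i => algebraMap F K (w i)) I with hB
  have h : Polynomial.aeval (sOp K w) q ∈ initialIdeal (fun i => (w i : ℝ)) I ↔ q ∈ B := Iff.rfl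
  rw [h, Submodule.IsPrincipal.mem_iff_generator_dvd B]
  change Submodule.IsPrincipal.generator B *
    Polynomial.C (Submodule.IsPrincipal.generator B).leadingCoeff⁻¹ ∣ q ↔ _
  by_cases h0 : Submodule.IsPrincipal.generator B = 0
  · rw [h0, zero_mul]
  · apply IsUnit.mul_right_dvd
    rw [Polynomial.isUnit_C]
    simpa using h0

theorem globalBFunction_monic {F : Subfield ℝ} [Algebra F K] (w : Fin n → F)
    (I : Ideal (D K n)) (h : globalBFunction w I ≠ 0) : (globalBFunction w I).Monic :=
  Polynomial.monic_mul_leadingCoeff_inv (left_ne_zero_of_mul h)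

end Initial

end DMod

end

/-!
The initial ideal `J = in_{(-w,w)}(I)` is a left ideal which is homogeneous for the `w`-grading, so
that it is also stable under right multiplication by `s = ∑ i, w_i x_i ∂_i`
(`mul_mem_initialIdeal`, `mul_sOp_mem_initialIdeal`). Hence right multiplication by `s` makes
`D_n / J` a module over `K[X]` on which `D_n` acts `K[X]`-linearly, and the theorem says that the
class of `1` is torsion for `K[X]`. The argument compares growth rates, where `B_k` denotes the
Bernstein filtration.

* The image of `B_k` in `D_n / J` has at most the dimension of its image in `D_n / I`: monomials
  that are independent modulo `J` are independent modulo `I`, because the initial form of a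
  relation modulo `I` is a relation modulo `J` (`finrank_map_quotientMap_le`). As `D_n / I` is
  holonomic, this dimension is `O(k^n)` (`IsHolonomic.exists_finrank_orbitFiltration_le`).
  The same bound holds for every quotient of `D_n / J`, in particular for `M = D_n / J'`, where
  `J'` is the preimage of the `K[X]`-torsion (`torsionClosure`).
* Suppose that `1` is not torsion. Then `M` is a nonzero torsion-free `K[X]`-module, and Joseph's
  proof of Bernstein's inequality works with coefficients in `K[X]`
  (`eq_zero_of_annihilates_orbitFiltration`): the free `K[X]`-module on the monomials of degree at
  most `k` embeds into the homomorphisms from the `K[X]`-span `N_k` of `B_k • 1` to `N_{2k}`. With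
  `d_k` the rank of `N_k`, the product `d_k d_{2k}` therefore grows at least like `k^{2n}`
  (`pow_le_finrank_mul_finrank`).
* As `s` lies in `B_2`, elements `m` of `B_k • 1` that are independent over `K[X]` give the elements
  `X^i m`, `i ≤ k`, of `B_{3k} • 1`, which are independent over `K`. Thus `(k + 1) d_k` is `O(k^n)`
  (`finrank_orbitSpan_mul_le`), which contradicts the lower bound for `d_k d_{2k}`
  (`not_growth_le_of_isTorsionFree`).

So `b(s) ∈ J` for some nonzero `b`, and `b(s) ≠ 0` because the Euler operator has infinitely many
eigenvalues on polynomials (`aeval_euler_ne_zero`).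
-/

noncomputable section

namespace DMod

/-! ### The Bernstein filtration and the centre -/

section Bernstein

variable {K : Type*} [Field K] {n : ℕ}

theorem mono_mem_bernstein {ab : (Fin n →₀ ℕ) × (Fin n →₀ ℕ)} {k : ℕ}
    (h : ab.1.degree + ab.2.degree ≤ k) : mono K ab ∈ bernstein K n k :=
  Submodule.subset_span ⟨ab, h, rfl⟩

theorem bernstein_monotone : Monotone (bernstein K n) := fun _ _ h =>
  Submodule.span_mono (Set.image_mono fun _ hab => le_trans hab h)

theorem mono_zero : mono K ((0, 0) : (Fin n →₀ ℕ) × (Fin n →₀ ℕ)) = 1 := by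
  simp [mono, xPow_zero, ddPow_zero]

theorem one_mem_bernstein (k : ℕ) : (1 : D K n) ∈ bernstein K n k := by
  rw [← mono_zero]
  exact mono_mem_bernstein (by simp)

theorem exists_smul_one_of_mem_bernstein_zero {p : D K n} (hp : p ∈ bernstein K n 0) :
    ∃ c : K, p = c • 1 := by
  have h : bernstein K n 0 ≤ Submodule.span K {1} := by
    refine Submodule.span_le.2 ?_
    rintro _ ⟨⟨α, β⟩, hab, rfl⟩
    have h1 : α = 0 := (Finsupp.degree_eq_zero_iff α).1 (by simp at hab; omega)
    have h2 : β = 0 := (Finsupp.degree_eq_zero_iff β).1 (by simp at hab; omega)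
    rw [h1, h2, mono_zero]
    exact Submodule.mem_span_singleton_self 1
  obtain ⟨c, hc⟩ := Submodule.mem_span_singleton.1 (h hp)
  exact ⟨c, hc.symm⟩

theorem x_mul_mem_bernstein (i : Fin n) {k : ℕ} {p : D K n} (hp : p ∈ bernstein K n k) :
    x K i * p ∈ bernstein K n (k + 1) := by
  have h : bernstein K n k ≤ (bernstein K n (k + 1)).comap (LinearMap.mulLeft K (x K i)) := by
    refine Submodule.span_le.2 ?_
    rintro _ ⟨⟨α, β⟩, hab, rfl⟩
    rw [SetLike.mem_coe, Submodule.mem_comap, LinearMap.mulLeft_apply]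
    rw [x_mul_mono]
    refine mono_mem_bernstein ?_
    simp only [Set.mem_ofPred_eq, map_add, Finsupp.degree_single] at hab ⊢
    omega
  simpa only [Submodule.mem_comap, LinearMap.mulLeft_apply] using h hp

theorem dd_mul_mem_bernstein (i : Fin n) {k : ℕ} {p : D K n} (hp : p ∈ bernstein K n k) :
    dd K i * p ∈ bernstein K n (k + 1) := by
  have h : bernstein K n k ≤ (bernstein K n (k + 1)).comap (LinearMap.mulLeft K (dd K i)) := by
    refine Submodule.span_le.2 ?_
    rintro _ ⟨⟨α, β⟩, hab, rfl⟩
    rw [SetLike.mem_coe, Submodule.mem_comap, LinearMap.mulLeft_apply]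
    rw [dd_mul_mono]
    refine Submodule.add_mem _ (mono_mem_bernstein ?_)
      (Submodule.smul_mem _ _ (mono_mem_bernstein ?_))
    · simp only [Set.mem_ofPred_eq, map_add, Finsupp.degree_single] at hab ⊢
      omega
    · have : (α - Finsupp.single i 1).degree ≤ α.degree := Finsupp.degree_mono tsub_le_self
      simp only [Set.mem_ofPred_eq] at hab ⊢
      omega
  simpa only [Submodule.mem_comap, LinearMap.mulLeft_apply] using h hp

/-- The Bernstein filtration is generated in degree one: `B_{k+1}` is spanned by `B_k` together
with the products of a generator of the Weyl algebra and an element of `B_k`. -/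
theorem bernstein_succ_le {k : ℕ} {V : Submodule K (D K n)} (h : bernstein K n k ≤ V)
    (hx : ∀ i, ∀ p ∈ bernstein K n k, x K i * p ∈ V)
    (hd : ∀ i, ∀ p ∈ bernstein K n k, dd K i * p ∈ V) : bernstein K n (k + 1) ≤ V := by
  have aux : ∀ {γ : Fin n →₀ ℕ}, γ ≠ 0 → ∃ i γ', γ = Finsupp.single i 1 + γ' := by
    intro γ hγ
    obtain ⟨i, hi⟩ := Finsupp.ne_iff.1 hγ
    have hi' : Finsupp.single i 1 ≤ γ :=
      Finsupp.single_le_iff.2 (Nat.one_le_iff_ne_zero.2 hi)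
    exact ⟨i, γ - Finsupp.single i 1, (add_tsub_cancel_of_le hi').symm⟩
  refine Submodule.span_le.2 ?_
  rintro _ ⟨⟨α, β⟩, hab, rfl⟩
  simp only [Set.mem_ofPred_eq] at hab
  by_cases hα : α = 0
  · by_cases hβ : β = 0
    · rw [hα, hβ, mono_zero]
      exact h (one_mem_bernstein k)
    · obtain ⟨i, β', rfl⟩ := aux hβ
      have h1 := dd_mul_mono (K := K) i 0 β'
      rw [Finsupp.zero_apply, Nat.cast_zero, zero_smul, add_zero] at h1
      rw [hα, ← h1]
      refine hd i _ (mono_mem_bernstein ?_)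
      simp only [map_add, Finsupp.degree_single, hα, map_zero] at hab ⊢
      omega
  · obtain ⟨i, α', rfl⟩ := aux hα
    rw [← x_mul_mono]
    refine hx i _ (mono_mem_bernstein ?_)
    simp only [map_add, Finsupp.degree_single] at hab ⊢
    omega

theorem mul_mem_bernstein {k l : ℕ} {p q : D K n} (hp : p ∈ bernstein K n k)
    (hq : q ∈ bernstein K n l) : p * q ∈ bernstein K n (k + l) := by
  induction k generalizing p with
  | zero =>
    obtain ⟨c, rfl⟩ := exists_smul_one_of_mem_bernstein_zero hp
    rw [smul_mul_assoc, one_mul, zero_add]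
    exact Submodule.smul_mem _ _ hq
  | succ k ih =>
    have h : bernstein K n (k + 1) ≤
        (bernstein K n (k + 1 + l)).comap (LinearMap.mulRight K q) := by
      refine bernstein_succ_le (fun p hp => ?_) ?_ ?_
      · rw [Submodule.mem_comap, LinearMap.mulRight_apply]
        exact bernstein_monotone (by omega) (ih hp)
      · intro i p hp
        rw [Submodule.mem_comap, LinearMap.mulRight_apply]
        rw [mul_assoc, add_right_comm]
        exact x_mul_mem_bernstein i (ih hp)
      · intro i p hp
        rw [Submodule.mem_comap, LinearMap.mulRight_apply]
        rw [mul_assoc, add_right_comm]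
        exact dd_mul_mem_bernstein i (ih hp)
    simpa only [Submodule.mem_comap, LinearMap.sub_apply, LinearMap.mulLeft_apply,
      LinearMap.mulRight_apply] using h hp

/-- Commutation with an element whose commutators with the generators are scalars lowers the
Bernstein degree by one. -/
theorem commutator_mem_bernstein {y : D K n}
    (hx : ∀ i, y * x K i - x K i * y ∈ bernstein K n 0)
    (hd : ∀ i, y * dd K i - dd K i * y ∈ bernstein K n 0) {k : ℕ} {p : D K n}
    (hp : p ∈ bernstein K n (k + 1)) : y * p - p * y ∈ bernstein K n k := by
  have leibniz : ∀ g p : D K n,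
      y * (g * p) - g * p * y = (y * g - g * y) * p + g * (y * p - p * y) := by
    intro g p
    noncomm_ring
  have hzero : ∀ p ∈ bernstein K n 0, y * p - p * y = 0 := by
    intro p hp
    obtain ⟨c, rfl⟩ := exists_smul_one_of_mem_bernstein_zero hp
    simp
  induction k generalizing p with
  | zero =>
    have h : bernstein K n (0 + 1) ≤
        (bernstein K n 0).comap (LinearMap.mulLeft K y - LinearMap.mulRight K y) := by
      refine bernstein_succ_le ?_ ?_ ?_
      · intro p hp
        rw [Submodule.mem_comap, LinearMap.sub_apply, LinearMap.mulLeft_apply,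
          LinearMap.mulRight_apply]
        rw [hzero p hp]
        exact Submodule.zero_mem _
      · intro i p hp
        rw [Submodule.mem_comap, LinearMap.sub_apply, LinearMap.mulLeft_apply,
          LinearMap.mulRight_apply]
        rw [leibniz, hzero p hp, mul_zero, add_zero]
        simpa only [Nat.add_zero] using mul_mem_bernstein (hx i) hp
      · intro i p hp
        rw [Submodule.mem_comap, LinearMap.sub_apply, LinearMap.mulLeft_apply,
          LinearMap.mulRight_apply]
        rw [leibniz, hzero p hp, mul_zero, add_zero]
        simpa only [Nat.add_zero] using mul_mem_bernstein (hd i) hp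
    simpa only [Submodule.mem_comap, LinearMap.sub_apply, LinearMap.mulLeft_apply,
      LinearMap.mulRight_apply] using h hp
  | succ k ih =>
    have h : bernstein K n (k + 1 + 1) ≤
        (bernstein K n (k + 1)).comap (LinearMap.mulLeft K y - LinearMap.mulRight K y) := by
      refine bernstein_succ_le ?_ ?_ ?_
      · intro p hp
        rw [Submodule.mem_comap, LinearMap.sub_apply, LinearMap.mulLeft_apply,
          LinearMap.mulRight_apply]
        exact bernstein_monotone (Nat.le_succ k) (ih hp)
      · intro i p hp
        rw [Submodule.mem_comap, LinearMap.sub_apply, LinearMap.mulLeft_apply,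
          LinearMap.mulRight_apply]
        rw [leibniz]
        refine Submodule.add_mem _ ?_ (x_mul_mem_bernstein i (ih hp))
        simpa using mul_mem_bernstein (hx i) hp
      · intro i p hp
        rw [Submodule.mem_comap, LinearMap.sub_apply, LinearMap.mulLeft_apply,
          LinearMap.mulRight_apply]
        rw [leibniz]
        refine Submodule.add_mem _ ?_ (dd_mul_mem_bernstein i (ih hp))
        simpa using mul_mem_bernstein (hd i) hp
    simpa only [Submodule.mem_comap, LinearMap.sub_apply, LinearMap.mulLeft_apply,
      LinearMap.mulRight_apply] using h hp

theorem x_commutator_mem_bernstein (i : Fin n) {k : ℕ} {p : D K n}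
    (hp : p ∈ bernstein K n (k + 1)) : x K i * p - p * x K i ∈ bernstein K n k := by
  refine commutator_mem_bernstein (fun j => ?_) (fun j => ?_) hp
  · rw [(x_comm i j).eq, sub_self]
    exact Submodule.zero_mem _
  · rw [dd_mul_x, sub_add_cancel_left]
    split_ifs
    · exact Submodule.neg_mem _ (one_mem_bernstein 0)
    · simp

theorem dd_commutator_mem_bernstein (i : Fin n) {k : ℕ} {p : D K n}
    (hp : p ∈ bernstein K n (k + 1)) : dd K i * p - p * dd K i ∈ bernstein K n k := by
  refine commutator_mem_bernstein (fun j => ?_) (fun j => ?_) hp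
  · rw [dd_mul_x, add_sub_cancel_left]
    split_ifs
    · exact one_mem_bernstein 0
    · exact Submodule.zero_mem _
  · rw [(dd_comm i j).eq, sub_self]
    exact Submodule.zero_mem _

theorem finite_degree_le (k : ℕ) :
    {ab : (Fin n →₀ ℕ) × (Fin n →₀ ℕ) | ab.1.degree + ab.2.degree ≤ k}.Finite := by
  refine ((Finsupp.finite_of_degree_le k).prod (Finsupp.finite_of_degree_le k)).subset ?_
  rintro ⟨α, β⟩ h
  simp only [Set.mem_ofPred_eq, Set.mem_prod] at h ⊢
  omega

instance finite_bernstein (k : ℕ) : Module.Finite K (bernstein K n k) :=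
  Module.Finite.span_of_finite K ((finite_degree_le k).image _)

/-- An induction principle for the Weyl algebra: a subspace that contains `1` and is stable under
left multiplication by the generators is everything. -/
theorem submodule_eq_top {V : Submodule K (D K n)} (h1 : (1 : D K n) ∈ V)
    (hx : ∀ i, ∀ p ∈ V, x K i * p ∈ V) (hd : ∀ i, ∀ p ∈ V, dd K i * p ∈ V) : V = ⊤ := by
  have hk : ∀ k, bernstein K n k ≤ V := by
    intro k
    induction k with
    | zero =>
      intro p hp
      obtain ⟨c, rfl⟩ := exists_smul_one_of_mem_bernstein_zero hp
      exact V.smul_mem c h1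
    | succ k ih =>
      exact bernstein_succ_le ih (fun i p hp => hx i p (ih hp)) fun i p hp => hd i p (ih hp)
  rw [eq_top_iff, ← span_mono, Submodule.span_le]
  rintro _ ⟨ab, rfl⟩
  exact hk _ (mono_mem_bernstein le_rfl)

theorem exists_mem_bernstein (p : D K n) : ∃ k, p ∈ bernstein K n k := by
  have hp : p ∈ Submodule.span K (Set.range (mono K : (Fin n →₀ ℕ) × (Fin n →₀ ℕ) → D K n)) := by
    rw [span_mono]
    exact Submodule.mem_top
  induction hp using Submodule.span_induction with
  | zero => exact ⟨0, Submodule.zero_mem _⟩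
  | add y z _ _ hy hz =>
    obtain ⟨k, hk⟩ := hy
    obtain ⟨l, hl⟩ := hz
    exact ⟨max k l, Submodule.add_mem _ (bernstein_monotone (le_max_left k l) hk)
      (bernstein_monotone (le_max_right k l) hl)⟩
  | smul c y _ hy =>
    obtain ⟨k, hk⟩ := hy
    exact ⟨k, Submodule.smul_mem _ c hk⟩
  | mem y hy =>
    obtain ⟨ab, rfl⟩ := hy
    exact ⟨_, mono_mem_bernstein le_rfl⟩

theorem euler_mem_bernstein (c : Fin n → K) : euler c ∈ bernstein K n 2 := by
  refine Submodule.sum_mem _ fun i _ => Submodule.smul_mem _ _ (x_mul_mem_bernstein i ?_)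
  simpa using dd_mul_mem_bernstein i (one_mem_bernstein (K := K) 0)

/-- The centre of the Weyl algebra in characteristic zero consists of the scalars. -/
theorem exists_smul_one_of_commute [CharZero K] {p : D K n} (hx : ∀ i, x K i * p = p * x K i)
    (hd : ∀ i, dd K i * p = p * dd K i) : ∃ c : K, p = c • 1 := by
  -- A central operator is multiplication by `g = p 1`, and all partial derivatives of `g` vanish.
  have hX : ∀ i (f : MvPolynomial (Fin n) K),
      p.1 (MvPolynomial.X i * f) = MvPolynomial.X i * p.1 f := fun i f =>
    (congrArg (fun q : D K n => q.1 f) (hx i)).symm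
  have hD : ∀ i (f : MvPolynomial (Fin n) K),
      p.1 (MvPolynomial.pderiv i f) = MvPolynomial.pderiv i (p.1 f) := fun i f =>
    (congrArg (fun q : D K n => q.1 f) (hd i)).symm
  have hmul : ∀ f : MvPolynomial (Fin n) K, p.1 f = f * p.1 1 := by
    intro f
    induction f using MvPolynomial.induction_on with
    | C a => rw [MvPolynomial.C_eq_smul_one, map_smul, smul_mul_assoc, one_mul]
    | add f g hf hg => rw [map_add, hf, hg, add_mul]
    | mul_X f i hf => rw [mul_comm, hX, hf, mul_assoc]
  have hder : ∀ i, MvPolynomial.pderiv i (p.1 1) = 0 := by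
    intro i
    rw [← hD, MvPolynomial.pderiv_one, map_zero]
  refine ⟨MvPolynomial.coeff 0 (p.1 1), ?_⟩
  have hC : p.1 1 = MvPolynomial.C (MvPolynomial.coeff 0 (p.1 1)) := by
    ext γ
    rw [MvPolynomial.coeff_C]
    split_ifs with h
    · rw [h]
    · obtain ⟨i, hi⟩ := Finsupp.ne_iff.1 (Ne.symm h)
      have h1 : γ - Finsupp.single i 1 + Finsupp.single i 1 = γ :=
        tsub_add_cancel_of_le (Finsupp.single_le_iff.2 (Nat.one_le_iff_ne_zero.2 hi))
      have h2 := MvPolynomial.coeff_pderiv (p.1 1) (i := i) (γ - Finsupp.single i 1)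
      rw [hder, h1, MvPolynomial.coeff_zero] at h2
      exact (mul_eq_zero.1 h2.symm).resolve_right (Nat.cast_add_one_ne_zero _)
  apply Subtype.ext
  refine LinearMap.ext fun f => ?_
  rw [hmul, hC, mul_comm, ← MvPolynomial.smul_eq_C_mul]
  simp
  rfl

end Bernstein

/-! ### Weights and the Euler operator -/

section Weights

variable {K : Type*} [Field K] {n : ℕ}

theorem x_mul_mem_weightSpan (w : Fin n → ℝ) (i : Fin n) {T T' : Set ℝ}
    (h : ∀ t ∈ T, t + -w i ∈ T') {p : D K n} (hp : p ∈ weightSpan w T) :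
    x K i * p ∈ weightSpan w T' := by
  induction hp using Submodule.span_induction with
  | zero => simp
  | add y z _ _ hy hz => rw [mul_add]; exact Submodule.add_mem _ hy hz
  | smul k y _ hy => rw [mul_smul_comm]; exact Submodule.smul_mem _ k hy
  | mem y hy =>
    obtain ⟨⟨α, β⟩, hab, rfl⟩ := hy
    rw [x_mul_mono]
    refine Submodule.subset_span ⟨_, ?_, rfl⟩
    have : weight w (Finsupp.single i 1 + α, β) = weight w (α, β) + -w i := by
      simp [weight, mul_add, Finset.sum_add_distrib, Finsupp.single_apply]
      ring
    rw [Set.mem_ofPred_eq, this]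
    exact h _ hab

theorem dd_mul_mem_weightSpan (w : Fin n → ℝ) (i : Fin n) {T T' : Set ℝ}
    (h : ∀ t ∈ T, t + w i ∈ T') {p : D K n} (hp : p ∈ weightSpan w T) :
    dd K i * p ∈ weightSpan w T' := by
  induction hp using Submodule.span_induction with
  | zero => simp
  | add y z _ _ hy hz => rw [mul_add]; exact Submodule.add_mem _ hy hz
  | smul k y _ hy => rw [mul_smul_comm]; exact Submodule.smul_mem _ k hy
  | mem y hy =>
    obtain ⟨⟨α, β⟩, hab, rfl⟩ := hy
    rw [dd_mul_mono]
    refine Submodule.add_mem _ (Submodule.subset_span ⟨_, ?_, rfl⟩) ?_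
    · have : weight w (α, Finsupp.single i 1 + β) = weight w (α, β) + w i := by
        simp [weight, mul_add, Finset.sum_add_distrib, Finsupp.single_apply]
        ring
      rw [Set.mem_ofPred_eq, this]
      exact h _ hab
    · by_cases h0 : α i = 0
      · simp [h0]
      · have h1 : Finsupp.single i 1 ≤ α :=
          Finsupp.single_le_iff.2 (Nat.one_le_iff_ne_zero.2 h0)
        obtain ⟨α', rfl⟩ := exists_add_of_le h1
        refine Submodule.smul_mem _ _ (Submodule.subset_span ⟨_, ?_, rfl⟩)
        have : weight w (Finsupp.single i 1 + α' - Finsupp.single i 1, β)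
            = weight w (Finsupp.single i 1 + α', β) + w i := by
          simp [weight, mul_add, Finset.sum_add_distrib, Finsupp.single_apply]
          ring
        rw [Set.mem_ofPred_eq, this]
        exact h _ hab

theorem euler_apply_monomial (c : Fin n → K) (γ : Fin n →₀ ℕ) :
    (euler c).1 (MvPolynomial.monomial γ 1)
      = (∑ i, c i * (γ i : K)) • MvPolynomial.monomial γ 1 := by
  have h : ∀ s : Finset (Fin n), (∑ i ∈ s, c i • (x K i * dd K i)).1
      (MvPolynomial.monomial γ (1 : K))
        = (∑ i ∈ s, c i * (γ i : K)) • MvPolynomial.monomial γ 1 := by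
    intro s
    induction s using Finset.induction_on with
    | empty => simp; rfl
    | insert i s hi ih =>
      rw [Finset.sum_insert hi, Finset.sum_insert hi, add_smul, ← ih]
      change c i • (MvPolynomial.X i * MvPolynomial.pderiv i (MvPolynomial.monomial γ (1 : K)))
        + (∑ i ∈ s, c i • (x K i * dd K i)).1 (MvPolynomial.monomial γ (1 : K)) = _
      congr 1
      rw [mul_smul, MvPolynomial.pderiv_monomial, MvPolynomial.X, MvPolynomial.monomial_mul]
      by_cases h0 : γ i = 0
      · simp [h0]
      · rw [add_tsub_cancel_of_le (Finsupp.single_le_iff.2 (Nat.one_le_iff_ne_zero.2 h0)),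
          MvPolynomial.smul_monomial]
        simp [MvPolynomial.smul_monomial]
  exact h Finset.univ

end Weights

/-! ### The initial ideal and its stability under `D_n` and `K[s]` -/

section InitialIdeal

variable {K : Type*} [Field K] [CharZero K] {n : ℕ}

theorem initialForm_ne_zero (w : Fin n → ℝ) {p : D K n} (hp : p ≠ 0) : initialForm w p ≠ 0 := by
  obtain ⟨m, a, ha, b, hb, ha0, rfl⟩ := exists_decomp w p hp
  rwa [initialForm_add w m ha hb ha0]

theorem initialForm_mem_initialIdeal (w : Fin n → ℝ) {I : Ideal (D K n)} {p : D K n}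
    (hp : p ∈ I) : initialForm w p ∈ initialIdeal w I :=
  Submodule.subset_span ⟨p, hp, rfl⟩

/-- Left multiplication by an element that is homogeneous of weight `δ` preserves the initial
ideal. -/
theorem homogeneous_mul_mem_initialIdeal (w : Fin n → ℝ) (I : Ideal (D K n)) {g : D K n} (δ : ℝ)
    (hg : ∀ (T T' : Set ℝ), (∀ t ∈ T, t + δ ∈ T') → ∀ p ∈ weightSpan w T, g * p ∈ weightSpan w T')
    {p : D K n} (hp : p ∈ initialIdeal w I) : g * p ∈ initialIdeal w I := by
  induction hp using Submodule.span_induction with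
  | zero => simp
  | add y z _ _ hy hz => rw [mul_add]; exact Submodule.add_mem _ hy hz
  | smul k y _ hy => rw [mul_smul_comm]; exact Submodule.smul_mem _ k hy
  | mem y hy =>
    obtain ⟨q, hq, rfl⟩ := hy
    by_cases hq0 : q = 0
    · rw [hq0, initialForm_zero, mul_zero]
      exact Submodule.zero_mem _
    obtain ⟨m, a, ha, b, hb, ha0, rfl⟩ := exists_decomp w q hq0
    rw [initialForm_add w m ha hb ha0]
    by_cases h0 : g * a = 0
    · rw [h0]
      exact Submodule.zero_mem _
    · have h1 : g * a ∈ weightSpan w {m + δ} :=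
        hg {m} {m + δ} (fun t ht => by rw [Set.mem_singleton_iff.1 ht]; rfl) a ha
      have h2 : g * b ∈ weightSpan w (Set.Iio (m + δ)) :=
        hg (Set.Iio m) (Set.Iio (m + δ)) (fun t ht => add_lt_add_left (Set.mem_Iio.1 ht) δ) b hb
      rw [← initialForm_add w (m + δ) h1 h2 h0, ← mul_add]
      exact initialForm_mem_initialIdeal w (I.mul_mem_left _ hq)

theorem mul_mem_initialIdeal (w : Fin n → ℝ) (I : Ideal (D K n)) (q : D K n) {p : D K n}
    (hp : p ∈ initialIdeal w I) : q * p ∈ initialIdeal w I := by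
  have hq : q ∈ (initialIdeal w I).comap (LinearMap.mulRight K p) := by
    rw [submodule_eq_top (V := (initialIdeal w I).comap (LinearMap.mulRight K p))]
    · exact Submodule.mem_top
    · rwa [Submodule.mem_comap, LinearMap.mulRight_apply, one_mul]
    · intro i q hq
      rw [Submodule.mem_comap, LinearMap.mulRight_apply] at hq ⊢
      rw [mul_assoc]
      exact homogeneous_mul_mem_initialIdeal w I (-w i)
        (fun _ _ h p hp => x_mul_mem_weightSpan w i h hp) hq
    · intro i q hq
      rw [Submodule.mem_comap, LinearMap.mulRight_apply] at hq ⊢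
      rw [mul_assoc]
      exact homogeneous_mul_mem_initialIdeal w I (w i)
        (fun _ _ h p hp => dd_mul_mem_weightSpan w i h hp) hq
  rwa [Submodule.mem_comap, LinearMap.mulRight_apply] at hq

theorem mono_mul_euler (c : Fin n → K) (ab : (Fin n →₀ ℕ) × (Fin n →₀ ℕ)) :
    mono K ab * euler c = euler c * mono K ab
      + (∑ i, c i * (ab.2 i : K) - ∑ i, c i * (ab.1 i : K)) • mono K ab := by
  obtain ⟨α, β⟩ := ab
  apply D_ext
  intro γ
  obtain ⟨k, hk, hk'⟩ := ddPow_apply (K := K) β γ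
  have h1 : (mono K (α, β)).1 (MvPolynomial.monomial γ 1)
      = k • MvPolynomial.monomial (α + (γ - β)) 1 := by
    change (xPow K α).1 ((ddPow K β).1 _) = _
    rw [hk', xPow_apply, MvPolynomial.monomial_mul, MvPolynomial.smul_monomial]
    simp
  change (mono K (α, β)).1 ((euler c).1 (MvPolynomial.monomial γ 1))
    = (euler c).1 ((mono K (α, β)).1 (MvPolynomial.monomial γ 1))
      + (∑ i, c i * (β i : K) - ∑ i, c i * (α i : K)) •
        ((mono K (α, β)).1 (MvPolynomial.monomial γ 1))
  rw [euler_apply_monomial, map_smul, h1, map_smul, euler_apply_monomial]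
  by_cases h0 : k = 0
  · simp [h0]
  · obtain ⟨δ, rfl⟩ := exists_add_of_le (hk.1 h0)
    rw [add_tsub_cancel_left, smul_comm k, ← add_smul]
    congr 1
    simp only [Finsupp.add_apply, Nat.cast_add, mul_add, Finset.sum_add_distrib]
    ring

/-- The initial ideal is homogeneous, so that right multiplication by the Euler operator preserves
it: on elements of weight `m` the commutator with `s = ∑ i, w_i x_i ∂_i` is multiplication by the
scalar `m`. -/
theorem mul_sOp_mem_initialIdeal {F : Subfield ℝ} [Algebra F K] (w : Fin n → F)
    (I : Ideal (D K n)) {p : D K n} (hp : p ∈ initialIdeal (fun i => (w i : ℝ)) I) :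
    p * sOp K w ∈ initialIdeal (fun i => (w i : ℝ)) I := by
  have hcomm : ∀ (m : ℝ) (a : D K n), a ∈ weightSpan (fun i => (w i : ℝ)) {m} →
      ∃ μ : K, a * sOp K w = sOp K w * a + μ • a := by
    intro m a ha
    by_cases hm : ∃ μ : F, (μ : ℝ) = m
    · obtain ⟨μ, hμ⟩ := hm
      refine ⟨algebraMap F K μ, ?_⟩
      induction ha using Submodule.span_induction with
      | zero => simp
      | add y z _ _ hy hz => rw [add_mul, hy, hz, mul_add, smul_add]; abel
      | smul k y _ hy => rw [smul_mul_assoc, hy, mul_smul_comm, smul_add, smul_comm k]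
      | mem y hy =>
        obtain ⟨ab, hab, rfl⟩ := hy
        have h1 : μ = ∑ i, w i * (ab.2 i : F) - ∑ i, w i * (ab.1 i : F) := by
          apply Subtype.ext
          rw [hμ, ← Set.mem_singleton_iff.1 hab, weight]
          push_cast
          ring
        rw [sOp, mono_mul_euler, h1]
        simp
    · -- All weights of monomials lie in `F`, so that `a = 0` for the other values of `m`.
      refine ⟨0, ?_⟩
      have h0 : a = 0 := by
        have h1 : {ab : (Fin n →₀ ℕ) × (Fin n →₀ ℕ) |
            weight (fun i => (w i : ℝ)) ab ∈ ({m} : Set ℝ)} = ∅ := by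
          refine Set.eq_empty_of_forall_notMem fun ab hab => hm
            ⟨-(∑ i, w i * (ab.1 i : F)) + ∑ i, w i * (ab.2 i : F), ?_⟩
          rw [← Set.mem_singleton_iff.1 hab, weight]
          push_cast
          rfl
        rw [weightSpan, h1, Set.image_empty, Submodule.span_empty] at ha
        exact (Submodule.mem_bot K).1 ha
      simp [h0]
  induction hp using Submodule.span_induction with
  | zero => simp
  | add y z _ _ hy hz => rw [add_mul]; exact Submodule.add_mem _ hy hz
  | smul k y _ hy => rw [smul_mul_assoc]; exact Submodule.smul_mem _ k hy
  | mem y hy =>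
    obtain ⟨q, hq, rfl⟩ := hy
    have hin := initialForm_mem_initialIdeal (fun i => (w i : ℝ)) hq
    by_cases hq0 : q = 0
    · rw [hq0, initialForm_zero, zero_mul]
      exact Submodule.zero_mem _
    obtain ⟨m, a, ha, b, hb, ha0, rfl⟩ := exists_decomp (fun i => (w i : ℝ)) q hq0
    rw [initialForm_add _ m ha hb ha0] at hin ⊢
    obtain ⟨μ, hμ⟩ := hcomm m a ha
    rw [hμ]
    exact Submodule.add_mem _ (mul_mem_initialIdeal _ I _ hin) (Submodule.smul_mem _ _ hin)

theorem support_repr_initialForm_subset (w : Fin n → ℝ) (p : D K n) :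
    ((monoBasis K n).repr (initialForm w p)).support ⊆ ((monoBasis K n).repr p).support := by
  classical
  have h : initialForm w p ∈ Submodule.span K
      (monoBasis K n '' (((monoBasis K n).repr p).support : Set _)) := by
    refine Submodule.sum_mem _ fun ab hab => Submodule.smul_mem _ _ (Submodule.subset_span ?_)
    exact ⟨ab, (Finset.mem_filter.1 hab).1, monoBasis_apply ab⟩
  rw [Module.Basis.mem_span_image] at h
  exact_mod_cast h

theorem aeval_euler_ne_zero {c : Fin n → K} (hc : c ≠ 0) {b : K[X]} (hb : b ≠ 0) :
    Polynomial.aeval (euler c) b ≠ 0 := by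
  -- The Euler operator has the infinitely many eigenvalues `c i * m`, `m ∈ ℕ`.
  obtain ⟨i, hi⟩ := Function.ne_iff.1 hc
  intro h
  have heig : ∀ (γ : Fin n →₀ ℕ) (q : K[X]), (Polynomial.aeval (euler c) q).1
      (MvPolynomial.monomial γ 1) = q.eval (∑ i, c i * (γ i : K)) • MvPolynomial.monomial γ 1 := by
    intro γ q
    induction q using Polynomial.induction_on' with
    | add q r hq hr =>
      rw [map_add, Polynomial.eval_add, add_smul, ← hq, ← hr]
      rfl
    | monomial k r =>
      rw [Polynomial.aeval_monomial, Polynomial.eval_monomial, ← Algebra.smul_def, mul_smul]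
      change r • ((euler c ^ k).1 (MvPolynomial.monomial γ 1)) = _
      congr 1
      induction k with
      | zero => rw [pow_zero, pow_zero, one_smul]; rfl
      | succ k ih =>
        rw [pow_succ, pow_succ']
        change (euler c ^ k).1 ((euler c).1 (MvPolynomial.monomial γ 1)) = _
        rw [euler_apply_monomial, map_smul, ih, mul_smul]
  have hroot : ∀ m : ℕ, b.IsRoot (c i * m) := by
    intro m
    have h1 := heig (Finsupp.single i m) b
    rw [h] at h1
    have h2 : ∑ j, c j * (Finsupp.single i m j : K) = c i * m := by
      rw [Finset.sum_eq_single i] <;> simp +contextual [eq_comm]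
    rw [h2] at h1
    have h3 : (0 : MvPolynomial (Fin n) K) = b.eval (c i * m) •
      MvPolynomial.monomial (Finsupp.single i m) 1 := h1
    exact (smul_eq_zero.1 h3.symm).resolve_right (by simp)
  refine hb (Polynomial.eq_zero_of_infinite_isRoot b ?_)
  refine (Set.infinite_range_of_injective (f := fun m : ℕ => c i * (m : K)) ?_).mono ?_
  · intro m m' hm
    exact Nat.cast_injective (mul_left_cancel₀ hi hm)
  · rintro _ ⟨m, rfl⟩
    exact hroot m

end InitialIdeal

/-! ### Linear independence over `K[X]` and monomials in a box -/

/-- A finite subset `S` of a torsion-free module over a domain contains a linearly independent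
subset with at least as many elements as the rank of the span of `S`. -/
theorem exists_linearIndepOn_finrank_span_le (R : Type*) [CommRing R] [IsDomain R] {M : Type*}
    [AddCommGroup M] [Module R M] [Module.IsTorsionFree R M] (S : Finset M) :
    ∃ T : Set S, LinearIndepOn R (fun m : S => (m : M)) T ∧
      Module.finrank R (Submodule.span R (S : Set M)) ≤ Nat.card T := by
  classical
  obtain ⟨T, hT, hTmax⟩ := exists_maximal_linearIndepOn R (fun m : S => (m : M))
  have hTfin : Fintype T := Fintype.ofFinite T
  choose! a ha0 ha using hTmax
  refine ⟨T, hT, ?_⟩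
  rw [Nat.card_eq_fintype_card]
  set V := Submodule.span R ((fun m : S => (m : M)) '' T) with hV
  -- A common multiple of the denominators moves the span of `S` into the span of `T`.
  set c : S → R := fun m => if m ∈ T then 1 else a m with hc
  have hc0 : ∏ m, c m ≠ 0 := by
    refine Finset.prod_ne_zero_iff.2 fun m _ => ?_
    simp only [hc]
    split_ifs with h
    · exact one_ne_zero
    · exact ha0 m h
  have hcm : ∀ m : S, c m • (m : M) ∈ V := by
    intro m
    simp only [hc]
    split_ifs with h
    · rw [one_smul]
      exact Submodule.subset_span ⟨m, h, rfl⟩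
    · exact ha m h
  have hle : Submodule.span R (S : Set M) ≤ V.comap (LinearMap.lsmul R M (∏ m, c m)) := by
    refine Submodule.span_le.2 fun m hm => ?_
    change (∏ m, c m) • m ∈ V
    rw [← Finset.prod_erase_mul _ _ (Finset.mem_univ (⟨m, hm⟩ : S)), mul_smul]
    exact V.smul_mem _ (hcm ⟨m, hm⟩)
  have hfin : Module.Finite R V := Module.Finite.span_of_finite _ (Set.toFinite _)
  have hinj : Function.Injective ((LinearMap.lsmul R M (∏ m, c m)).restrict
      (p := Submodule.span R (S : Set M)) (q := V) fun m hm => hle hm) := by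
    intro m m' h
    exact Subtype.ext (smul_right_injective M hc0 (congrArg Subtype.val h))
  refine (LinearMap.finrank_le_finrank_of_injective hinj).trans ?_
  rw [hV, Set.image_eq_range]
  exact finrank_range_le_card _

/-- The `X`-powers of elements independent over `K[X]` are independent over `K`. -/
theorem linearIndependent_X_pow_smul {K M : Type*} [Field K] [AddCommGroup M] [Module K M]
    [Module K[X] M] [IsScalarTower K K[X] M] {ι : Type*} {c : ι → M}
    (hc : LinearIndependent K[X] c) (k : ℕ) :
    LinearIndependent K fun p : Fin (k + 1) × ι => (Polynomial.X : K[X]) ^ (p.1 : ℕ) • c p.2 := by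
  have hpow : LinearIndependent K fun i : Fin (k + 1) => (Polynomial.X : K[X]) ^ (i : ℕ) := by
    have h := (Polynomial.basisMonomials K).linearIndependent.comp _
      (Fin.val_injective (n := k + 1))
    convert h using 2 with i
    simp [Polynomial.coe_basisMonomials, Polynomial.X_pow_eq_monomial]
  exact linearIndependent_smul hpow hc

/-- The monomial whose exponents are the entries of a pair of vectors bounded by `j`. -/
def boxExponent {n : ℕ} (j : ℕ) (a : (Fin n → Fin (j + 1)) × (Fin n → Fin (j + 1))) :
    (Fin n →₀ ℕ) × (Fin n →₀ ℕ) :=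
  (Finsupp.equivFunOnFinite.symm fun i => a.1 i, Finsupp.equivFunOnFinite.symm fun i => a.2 i)

theorem boxExponent_injective (n j : ℕ) : Function.Injective (boxExponent (n := n) j) := by
  rintro ⟨a, b⟩ ⟨a', b'⟩ h
  simp only [boxExponent, Prod.mk.injEq, EmbeddingLike.apply_eq_iff_eq] at h
  refine Prod.ext (funext fun i => ?_) (funext fun i => ?_)
  · exact Fin.ext (congrFun h.1 i)
  · exact Fin.ext (congrFun h.2 i)

theorem boxExponent_degree_le {n : ℕ} (j : ℕ) (a : (Fin n → Fin (j + 1)) × (Fin n → Fin (j + 1))) :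
    (boxExponent j a).1.degree + (boxExponent j a).2.degree ≤ 2 * n * j := by
  have h : ∀ b : Fin n → Fin (j + 1), ∑ i, (b i : ℕ) ≤ n * j := by
    intro b
    refine (Finset.sum_le_card_nsmul _ _ j fun i _ => Nat.lt_succ_iff.1 (b i).2).trans ?_
    simp
  rw [Finsupp.degree_eq_sum, Finsupp.degree_eq_sum]
  have h1 := h a.1
  have h2 := h a.2
  simp only [boxExponent, Finsupp.equivFunOnFinite_symm_apply_apply]
  linarith

/-! ### Growth of cyclic modules with a commuting endomorphism -/

section Growth

variable {K : Type*} [Field K] {n : ℕ}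
  {M : Type*} [AddCommGroup M] [Module K M] [Module (D K n) M] [IsScalarTower K (D K n) M]

/-- The `k`-th step `B_k • v` of the filtration of the cyclic module `D_n • v` induced by the
Bernstein filtration. -/
def orbitFiltration (v : M) (k : ℕ) : Submodule K M :=
  (bernstein K n k).map ((LinearMap.toSpanSingleton (D K n) M v).restrictScalars K)

theorem mem_orbitFiltration {v m : M} {k : ℕ} :
    m ∈ orbitFiltration (K := K) (n := n) v k ↔ ∃ p ∈ bernstein K n k, p • v = m := Iff.rfl

theorem smul_mem_orbitFiltration {v m : M} {k l : ℕ} {p : D K n} (hp : p ∈ bernstein K n l)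
    (hm : m ∈ orbitFiltration (K := K) (n := n) v k) :
    p • m ∈ orbitFiltration (K := K) (n := n) v (l + k) := by
  obtain ⟨q, hq, rfl⟩ := mem_orbitFiltration.1 hm
  exact mem_orbitFiltration.2 ⟨p * q, mul_mem_bernstein hp hq, mul_smul p q v⟩

theorem orbitFiltration_monotone (v : M) :
    Monotone (orbitFiltration (K := K) (n := n) v) :=
  fun _ _ h => Submodule.map_mono (bernstein_monotone h)

theorem exists_finset_span_eq_orbitFiltration (v : M) (k : ℕ) : ∃ S : Finset M,
    Submodule.span K (S : Set M) = orbitFiltration (K := K) (n := n) v k :=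
  (Module.Finite.iff_fg.1 (inferInstance : Module.Finite K (bernstein K n k))).map _

instance finite_orbitFiltration (v : M) (k : ℕ) :
    Module.Finite K (orbitFiltration (K := K) (n := n) v k) :=
  Module.Finite.map (bernstein K n k) _

variable [Module K[X] M]

variable (K n) in
/-- The `K[X]`-submodule generated by `B_k • v`. -/
def orbitSpan (v : M) (k : ℕ) : Submodule K[X] M :=
  Submodule.span K[X] (orbitFiltration (K := K) (n := n) v k : Set M)

theorem exists_finset_span_eq_orbitSpan [IsScalarTower K K[X] M] (v : M) (k : ℕ) : ∃ S : Finset M,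
    (S : Set M) ⊆ orbitFiltration (K := K) (n := n) v k ∧
      Submodule.span K[X] (S : Set M) = orbitSpan K n v k := by
  obtain ⟨S, hS⟩ := exists_finset_span_eq_orbitFiltration (K := K) (n := n) v k
  refine ⟨S, ?_, ?_⟩
  · rw [← hS]
    exact Submodule.subset_span
  · rw [orbitSpan, ← hS, Submodule.span_span_of_tower]

instance finite_orbitSpan [IsScalarTower K K[X] M] (v : M) (k : ℕ) :
    Module.Finite K[X] (orbitSpan K n v k) := by
  obtain ⟨S, -, hS⟩ := exists_finset_span_eq_orbitSpan (K := K) (n := n) v k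
  rw [← hS]
  exact Module.Finite.span_finset _ S

theorem smul_mem_orbitSpan [SMulCommClass (D K n) K[X] M] {v m : M} {k l : ℕ} {p : D K n}
    (hp : p ∈ bernstein K n l) (hm : m ∈ orbitSpan K n v k) : p • m ∈ orbitSpan K n v (l + k) := by
  have h : orbitSpan K n v k ≤
      (orbitSpan K n v (l + k)).comap (DistribSMul.toLinearMap K[X] M p) :=
    Submodule.span_le.2 fun m hm => Submodule.subset_span (smul_mem_orbitFiltration hp hm)
  exact h hm

theorem X_pow_smul_mem_orbitFiltration [SMulCommClass (D K n) K[X] M] {v : M} {σ : D K n}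
    (hσ : σ ∈ bernstein K n 2)
    (hX : (Polynomial.X : K[X]) • v = σ • v) (i l : ℕ) {m : M}
    (hm : m ∈ orbitFiltration (K := K) (n := n) v l) :
    (Polynomial.X : K[X]) ^ i • m ∈ orbitFiltration (K := K) (n := n) v (l + 2 * i) := by
  induction i generalizing l m with
  | zero => simpa using hm
  | succ i ih =>
    obtain ⟨p, hp, rfl⟩ := mem_orbitFiltration.1 hm
    have h1 := ih (l + 2) (mem_orbitFiltration.2 ⟨_, mul_mem_bernstein hp hσ, rfl⟩)
    rw [mul_smul, ← hX, smul_comm p, ← mul_smul, ← pow_succ] at h1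
    rwa [show l + 2 * (i + 1) = l + 2 + 2 * i by ring]

variable [IsScalarTower K K[X] M] [SMulCommClass (D K n) K[X] M]

/-- Joseph's lemma with a central parameter: an operator `∑ X^i p_i` with coefficients `p_i` in
`B_k` that annihilates `B_k • v` vanishes. Its commutators with the generators have coefficients in
`B_{k-1}` and annihilate `B_{k-1} • v`, so that by induction the `p_i` are central. -/
theorem eq_zero_of_annihilates_orbitFiltration [CharZero K] {v : M}
    (hv : ∀ b : K[X], b • v = 0 → b = 0) (N : ℕ) {k : ℕ} {p : ℕ → D K n}
    (hp : ∀ i, p i ∈ bernstein K n k)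
    (h : ∀ m ∈ orbitFiltration (K := K) (n := n) v k,
      ∑ i ∈ Finset.range N, (Polynomial.X : K[X]) ^ i • p i • m = 0) :
    ∀ i < N, p i = 0 := by
  -- The case of scalar coefficients, where the hypothesis is only needed for `v` itself.
  have hscalar : ∀ p : ℕ → D K n,
      ∑ i ∈ Finset.range N, (Polynomial.X : K[X]) ^ i • p i • v = 0 →
      (∀ i < N, ∃ c : K, p i = c • 1) → ∀ i < N, p i = 0 := by
    intro p h1 hc
    choose! c hc using hc
    have h2 : (∑ i ∈ Finset.range N, Polynomial.monomial i (c i)) • v = 0 := by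
      rw [Finset.sum_smul, ← h1]
      refine Finset.sum_congr rfl fun i hi => ?_
      rw [hc i (Finset.mem_range.1 hi), smul_assoc, one_smul, smul_comm, ← smul_assoc,
        Polynomial.smul_X_eq_monomial]
    intro i hi
    have h3 := congrArg (fun b => Polynomial.coeff b i) (hv _ h2)
    simp only [Polynomial.finsetSum_coeff, Polynomial.coeff_monomial, Finset.sum_ite_eq',
      Finset.mem_range, hi, if_true, Polynomial.coeff_zero] at h3
    rw [hc i hi, h3, zero_smul]
  have hmem : ∀ k, v ∈ orbitFiltration (K := K) (n := n) v k :=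
    fun k => mem_orbitFiltration.2 ⟨1, one_mem_bernstein k, one_smul _ v⟩
  induction k generalizing p with
  | zero =>
    exact hscalar p (h v (hmem 0)) fun i _ => exists_smul_one_of_mem_bernstein_zero (hp i)
  | succ k ih =>
    have hcomm : ∀ g ∈ bernstein K n 1, (∀ i, g * p i - p i * g ∈ bernstein K n k) →
        ∀ i < N, g * p i = p i * g := by
      intro g hg hgp i hi
      refine sub_eq_zero.1 (ih hgp (fun m hm => ?_) i hi)
      have h1 := h m (orbitFiltration_monotone v (Nat.le_succ k) hm)
      have h2 := h (g • m) (by rw [add_comm k 1]; exact smul_mem_orbitFiltration hg hm)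
      have h3 : ∑ i ∈ Finset.range N, (Polynomial.X : K[X]) ^ i • (g * p i - p i * g) • m
          = g • ∑ i ∈ Finset.range N, (Polynomial.X : K[X]) ^ i • p i • m
            - ∑ i ∈ Finset.range N, (Polynomial.X : K[X]) ^ i • p i • g • m := by
        rw [Finset.smul_sum, ← Finset.sum_sub_distrib]
        refine Finset.sum_congr rfl fun i _ => ?_
        rw [sub_smul, smul_sub, mul_smul, mul_smul,
          smul_comm g ((Polynomial.X : K[X]) ^ i)]
      rw [h3, h1, h2, smul_zero, sub_zero]
    refine hscalar p (h v (hmem _)) fun i hi =>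
      exists_smul_one_of_commute (fun j => ?_) fun j => ?_
    · refine hcomm _ ?_ (fun i => x_commutator_mem_bernstein j (hp i)) i hi
      simpa using x_mul_mem_bernstein j (one_mem_bernstein (K := K) 0)
    · refine hcomm _ ?_ (fun i => dd_commutator_mem_bernstein j (hp i)) i hi
      simpa using dd_mul_mem_bernstein j (one_mem_bernstein (K := K) 0)

variable [Module.IsTorsionFree K[X] M]

/-- Bernstein's inequality over `K[X]`: for `k = 2nj`, the free module on the `(j + 1)^{2n}`
monomials of `B_k` with all exponents at most `j` embeds into the homomorphisms from the span of
`B_k • v` to that of `B_{2k} • v`. -/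
theorem pow_le_finrank_mul_finrank [CharZero K] {v : M}
    (hv : ∀ b : K[X], b • v = 0 → b = 0) (j : ℕ) :
    (j + 1) ^ (2 * n) ≤ Module.finrank K[X] (orbitSpan K n v (2 * n * j)) *
      Module.finrank K[X] (orbitSpan K n v (2 * n * j + 2 * n * j)) := by
  classical
  set k := 2 * n * j with hk
  have hmem : ∀ a, mono K (boxExponent j a) ∈ bernstein K n k :=
    fun a => mono_mem_bernstein (boxExponent_degree_le j a)
  let L : (Fin n → Fin (j + 1)) × (Fin n → Fin (j + 1)) →
      (orbitSpan K n v k →ₗ[K[X]] orbitSpan K n v (k + k)) := fun a =>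
    (DistribSMul.toLinearMap K[X] M (mono K (boxExponent j a))).restrict
      fun m hm => smul_mem_orbitSpan (hmem a) hm
  have hinj : Function.Injective (Fintype.linearCombination K[X] L) := by
    rw [injective_iff_map_eq_zero]
    intro r hr
    set N := ∑ a, ((r a).natDegree + 1) with hN
    have hdeg : ∀ a, (r a).natDegree < N := fun a =>
      Finset.single_le_sum (f := fun a => (r a).natDegree + 1) (fun _ _ => Nat.zero_le _)
        (Finset.mem_univ a)
    have hzero := eq_zero_of_annihilates_orbitFiltration hv N (k := k)
      (p := fun i => ∑ a, (r a).coeff i • mono K (boxExponent j a))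
      (fun i => Submodule.sum_mem _ fun a _ => Submodule.smul_mem _ _ (hmem a)) ?_
    · funext a
      ext i
      by_cases hi : i < N
      · exact Fintype.linearIndependent_iff.1
          (linearIndependent_mono.comp _ (boxExponent_injective n j)) _ (hzero i hi) a
      · rw [Polynomial.coeff_eq_zero_of_natDegree_lt (by have := hdeg a; omega)]
        rfl
    · intro m hm
      have h1 := congrArg Subtype.val (LinearMap.congr_fun hr
        (⟨m, Submodule.subset_span hm⟩ : orbitSpan K n v k))
      have h2 : ∑ a, r a • mono K (boxExponent j a) • m = 0 := by
        rw [Fintype.linearCombination_apply, LinearMap.sum_apply, Submodule.coe_sum] at h1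
        exact h1
      rw [← h2]
      simp only [Finset.sum_smul, Finset.smul_sum]
      rw [Finset.sum_comm]
      refine Finset.sum_congr rfl fun a _ => ?_
      nth_rewrite 2 [(r a).as_sum_range' N (hdeg a)]
      rw [Finset.sum_smul]
      refine Finset.sum_congr rfl fun i _ => ?_
      rw [smul_assoc, smul_comm, ← smul_assoc, Polynomial.smul_X_eq_monomial]
  have h := LinearMap.finrank_le_finrank_of_injective hinj
  rw [Module.finrank_linearMap, Module.finrank_fintype_fun_eq_card] at h
  refine le_trans (le_of_eq ?_) h
  simp [two_mul, pow_add]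

/-- If `X` raises the filtration degree by at most two, then each unit of `K[X]`-rank of
`B_k • v` contributes the `k + 1` independent elements `m, X m, …, X^k m` to `B_{3k} • v`. -/
theorem finrank_orbitSpan_mul_le {v : M} {σ : D K n} (hσ : σ ∈ bernstein K n 2)
    (hX : (Polynomial.X : K[X]) • v = σ • v) (k : ℕ) :
    (k + 1) * Module.finrank K[X] (orbitSpan K n v k)
      ≤ Module.finrank K (orbitFiltration (K := K) (n := n) v (3 * k)) := by
  obtain ⟨S, hSsub, hS⟩ := exists_finset_span_eq_orbitSpan (K := K) (n := n) v k
  obtain ⟨T, hT, hrank⟩ := exists_linearIndepOn_finrank_span_le K[X] S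
  rw [hS] at hrank
  have hTfin : Fintype T := Fintype.ofFinite T
  rw [Nat.card_eq_fintype_card] at hrank
  have hind := linearIndependent_X_pow_smul hT k
  have hmem : ∀ p : Fin (k + 1) × T, (Polynomial.X : K[X]) ^ (p.1 : ℕ) • ((p.2 : S) : M)
      ∈ orbitFiltration (K := K) (n := n) v (3 * k) := by
    rintro ⟨i, m⟩
    have h1 : k + 2 * (i : ℕ) ≤ 3 * k := by
      have := i.2
      omega
    have h2 : ((m : S) : M) ∈ orbitFiltration (K := K) (n := n) v k := hSsub m.1.2
    have h3 := X_pow_smul_mem_orbitFiltration hσ hX i k h2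
    exact orbitFiltration_monotone v h1 h3
  have hind' : LinearIndependent K fun p : Fin (k + 1) × T =>
      (⟨_, hmem p⟩ : orbitFiltration (K := K) (n := n) v (3 * k)) :=
    LinearIndependent.of_comp (Submodule.subtype _) hind
  have hcard := hind'.fintype_card_le_finrank
  rw [Fintype.card_prod, Fintype.card_fin] at hcard
  exact (Nat.mul_le_mul_left _ hrank).trans hcard

/-- A nonzero cyclic `D_n`-module `D_n • v` with an endomorphism `X` for which it is torsion-free
over `K[X]` has growth larger than `n`: the product of the ranks over `K[X]` of the spans of
`B_k • v` and `B_{2k} • v` already grows with degree at least `2n`, and the powers of `X` contribute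
one more degree to each factor. -/
theorem not_growth_le_of_isTorsionFree [CharZero K] (hn : 0 < n) {v : M}
    (hv : ∀ b : K[X], b • v = 0 → b = 0) {σ : D K n} (hσ : σ ∈ bernstein K n 2)
    (hX : (Polynomial.X : K[X]) • v = σ • v) (A k₀ : ℕ)
    (hA : ∀ k, k₀ ≤ k →
      Module.finrank K (orbitFiltration (K := K) (n := n) v k) ≤ A * (k + 1) ^ n) : False := by
  -- With `q = j + 1` and `k = 2nj`, the two bounds give `(k + 1) (2k + 1) q^{2n} ≤ C q^{2n}`.
  set C := (A * (6 * n + 1) ^ n) * (A * (12 * n + 1) ^ n) with hC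
  set j := max k₀ C with hj
  set k := 2 * n * j with hk
  have hjk : j ≤ k := Nat.le_mul_of_pos_left j (by omega)
  have hk₀ : k₀ ≤ j := le_max_left _ _
  have hCj : C ≤ j := le_max_right _ _
  have h0 := pow_le_finrank_mul_finrank (K := K) (n := n) hv j
  rw [← hk] at h0
  set d := Module.finrank K[X] (orbitSpan K n v k)
  set d' := Module.finrank K[X] (orbitSpan K n v (k + k))
  have h1 : (k + 1) * d ≤ A * (6 * n + 1) ^ n * (j + 1) ^ n := by
    refine (finrank_orbitSpan_mul_le hσ hX k).trans ((hA _ (by omega)).trans ?_)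
    rw [mul_assoc, ← mul_pow]
    refine Nat.mul_le_mul_left _ (Nat.pow_le_pow_left ?_ n)
    rw [hk]
    nlinarith
  have h2 : (k + k + 1) * d' ≤ A * (12 * n + 1) ^ n * (j + 1) ^ n := by
    refine (finrank_orbitSpan_mul_le hσ hX (k + k)).trans ((hA _ (by omega)).trans ?_)
    rw [mul_assoc, ← mul_pow]
    refine Nat.mul_le_mul_left _ (Nat.pow_le_pow_left ?_ n)
    rw [hk]
    nlinarith
  have h3 : (k + 1) * (k + k + 1) * (j + 1) ^ (2 * n) ≤ C * (j + 1) ^ (2 * n) := by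
    calc (k + 1) * (k + k + 1) * (j + 1) ^ (2 * n)
        ≤ (k + 1) * (k + k + 1) * (d * d') := Nat.mul_le_mul_left _ h0
      _ = ((k + 1) * d) * ((k + k + 1) * d') := by ring
      _ ≤ _ := Nat.mul_le_mul h1 h2
      _ = C * (j + 1) ^ (2 * n) := by rw [hC]; ring
  have h4 := Nat.le_of_mul_le_mul_right h3 (by positivity)
  nlinarith

end Growth

/-! ### Growth modulo the initial ideal -/

section Quotient

variable {K : Type*} [Field K] {n : ℕ}

/-- The quotient map `D_n → D_n / I` as a `K`-linear map. -/
def quotientMap (I : Ideal (D K n)) : D K n →ₗ[K] D K n ⧸ I := I.mkQ.restrictScalars K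

theorem quotientMap_eq_zero {I : Ideal (D K n)} {p : D K n} : quotientMap I p = 0 ↔ p ∈ I :=
  Submodule.Quotient.mk_eq_zero I

theorem orbitFiltration_quotientMap_one (I : Ideal (D K n)) (k : ℕ) :
    orbitFiltration (K := K) (n := n) (quotientMap I 1) k
      = (bernstein K n k).map (quotientMap I) := by
  have h : ∀ p : D K n, p • quotientMap I 1 = quotientMap I p := fun p => by
    rw [quotientMap, LinearMap.restrictScalars_apply, LinearMap.restrictScalars_apply,
      ← map_smul, smul_eq_mul, mul_one]
  ext m
  rw [mem_orbitFiltration, Submodule.mem_map]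
  simp only [h]

variable [CharZero K]

/-- Passing to initial forms does not increase the growth: the monomials that form a basis of the
image of `B_k` modulo a subspace containing all initial forms of `I` remain independent modulo `I`,
since a relation between them modulo `I` would have its initial form as a relation. -/
theorem finrank_map_quotientMap_le (w : Fin n → ℝ) (I : Ideal (D K n)) {V : Ideal (D K n)}
    (hV : initialIdeal w I ≤ V.restrictScalars K) (k : ℕ) :
    Module.finrank K ((bernstein K n k).map (quotientMap V))
      ≤ Module.finrank K ((bernstein K n k).map (quotientMap I)) := by
  classical
  set A := {ab : (Fin n →₀ ℕ) × (Fin n →₀ ℕ) | ab.1.degree + ab.2.degree ≤ k} with hA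
  have : Finite A := finite_degree_le k
  obtain ⟨κ, a, ha, hspan, hind⟩ :=
    exists_linearIndependent' K fun ab : A => (quotientMap V) (mono K ab.1)
  have : Finite κ := Finite.of_injective a ha
  have : Fintype κ := Fintype.ofFinite κ
  have hB : (bernstein K n k).map (quotientMap V)
      = Submodule.span K (Set.range ((fun ab : A => (quotientMap V) (mono K ab.1)) ∘ a)) := by
    rw [hspan, bernstein, Submodule.map_span, Set.image_image, Set.image_eq_range]
  rw [hB, finrank_span_eq_card hind]
  have hvmem : ∀ c, (quotientMap I) (mono K (a c).1)
      ∈ (bernstein K n k).map (quotientMap I) :=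
    fun c => Submodule.mem_map_of_mem (mono_mem_bernstein (a c).2)
  have hind' : LinearIndependent K fun c => (quotientMap I) (mono K (a c).1) := by
    rw [Fintype.linearIndependent_iff]
    intro g hg
    have hmono : LinearIndependent K fun c => mono K (a c).1 :=
      linearIndependent_mono.comp (fun c => (a c).1) (Subtype.val_injective.comp ha)
    set p := ∑ c, g c • mono K (a c).1 with hp
    have hpI : p ∈ I := by
      simp only [← map_smul, ← map_sum] at hg
      exact quotientMap_eq_zero.1 hg
    suffices hp0 : p = 0 from Fintype.linearIndependent_iff.1 hmono g hp0
    by_contra hp0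
    have hsupp : (((monoBasis K n).repr p).support : Set _) ⊆ Set.range fun c => (a c).1 := by
      rw [← Module.Basis.mem_span_image]
      refine Submodule.sum_mem _ fun c _ => Submodule.smul_mem _ _ (Submodule.subset_span ?_)
      exact ⟨_, ⟨c, rfl⟩, monoBasis_apply _⟩
    have hin : initialForm w p ∈ Submodule.span K (Set.range fun c => mono K (a c).1) := by
      have h1 : initialForm w p ∈ Submodule.span K
          (monoBasis K n '' (Set.range fun c => (a c).1)) := by
        rw [Module.Basis.mem_span_image]
        exact subset_trans (by exact_mod_cast support_repr_initialForm_subset w p) hsupp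
      rw [← Set.range_comp] at h1
      convert h1 using 4
      exact (monoBasis_apply _).symm
    obtain ⟨g', hg'⟩ := (Submodule.mem_span_range_iff_exists_fun K).1 hin
    have h2 : ∑ c, g' c • (quotientMap V) (mono K (a c).1) = 0 := by
      simp only [← map_smul, ← map_sum]
      rw [hg']
      exact quotientMap_eq_zero.2 (hV (initialForm_mem_initialIdeal w hpI))
    have h3 := Fintype.linearIndependent_iff.1 hind g' h2
    refine initialForm_ne_zero w hp0 ?_
    rw [← hg']
    exact Finset.sum_eq_zero fun c _ => by rw [h3 c, zero_smul]
  have hind'' : LinearIndependent K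
      fun c => (⟨_, hvmem c⟩ : (bernstein K n k).map (quotientMap I)) :=
    LinearIndependent.of_comp (Submodule.subtype _) hind'
  exact hind''.fintype_card_le_finrank

end Quotient

/-! ### Growth of holonomic modules -/

section HolonomicGrowth

theorem exists_eval_natCast_le (χ : ℚ[X]) : ∃ A : ℕ, ∀ k : ℕ,
    χ.eval (k : ℚ) ≤ A * ((k : ℚ) + 1) ^ χ.natDegree := by
  obtain ⟨A, hA⟩ := exists_nat_ge (∑ i ∈ Finset.range (χ.natDegree + 1), |χ.coeff i|)
  refine ⟨A, fun k => ?_⟩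
  have h1 : ∀ i ∈ Finset.range (χ.natDegree + 1),
      χ.coeff i * (k : ℚ) ^ i ≤ |χ.coeff i| * ((k : ℚ) + 1) ^ χ.natDegree := by
    intro i hi
    have hk : (k : ℚ) ^ i ≤ ((k : ℚ) + 1) ^ χ.natDegree :=
      (pow_le_pow_left₀ (by positivity) (by linarith) i).trans
        (pow_le_pow_right₀ (by linarith [(Nat.cast_nonneg k : (0 : ℚ) ≤ k)])
          (Nat.lt_succ_iff.1 (Finset.mem_range.1 hi)))
    exact mul_le_mul (le_abs_self _) hk (by positivity) (abs_nonneg _)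
  rw [Polynomial.eval_eq_sum_range]
  refine (Finset.sum_le_sum h1).trans ?_
  rw [← Finset.sum_mul]
  exact mul_le_mul_of_nonneg_right hA (by positivity)

variable {K : Type*} [Field K] {n : ℕ}
  {M : Type*} [AddCommGroup M] [Module K M] [Module (D K n) M] [IsScalarTower K (D K n) M]

instance finite_inducedFiltration (S : Finset M) (k : ℕ) :
    Module.Finite K (inducedFiltration K n S k) := by
  have hfin : Module.Finite K
      (S.sup fun s => orbitFiltration (K := K) (n := n) s k : Submodule K M) :=
    Submodule.finite_finset_sup S _
  have hle : inducedFiltration K n S k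
      ≤ S.sup fun s => orbitFiltration (K := K) (n := n) s k := by
    refine Submodule.span_le.2 ?_
    rintro _ ⟨P, hP, v, hv, rfl⟩
    exact Finset.le_sup (f := fun s => orbitFiltration (K := K) (n := n) s k) hv
      (mem_orbitFiltration.2 ⟨P, hP, rfl⟩)
  exact Submodule.finiteDimensional_of_le hle

/-- The filtration generated by one element of a holonomic module has growth at most `n`. -/
theorem IsHolonomic.exists_finrank_orbitFiltration_le (hM : IsHolonomic K n M) (v : M) :
    ∃ A k₀ : ℕ, ∀ k, k₀ ≤ k →
      Module.finrank K (orbitFiltration (K := K) (n := n) v k) ≤ A * (k + 1) ^ n := by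
  classical
  rcases hM with hM | ⟨S, hS, χ, hχ, hev⟩
  · refine ⟨0, 0, fun k _ => ?_⟩
    rw [Module.finrank_zero_of_subsingleton]
    exact Nat.zero_le _
  obtain ⟨A, hA⟩ := exists_eval_natCast_le χ
  obtain ⟨k₀, hk₀⟩ := Filter.eventually_atTop.1 hev
  have hv : v ∈ Submodule.span (D K n) (S : Set M) := by
    rw [hS]
    exact Submodule.mem_top
  obtain ⟨f, -, hf⟩ := Submodule.mem_span_finset.1 hv
  choose e he using fun p : D K n => exists_mem_bernstein p
  set c := S.sup fun s => e (f s) with hc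
  have hle : ∀ k, orbitFiltration (K := K) (n := n) v k ≤ inducedFiltration K n S (k + c) := by
    intro k m hm
    obtain ⟨p, hp, rfl⟩ := mem_orbitFiltration.1 hm
    rw [← hf, Finset.smul_sum]
    refine Submodule.sum_mem _ fun s hs => ?_
    rw [← mul_smul]
    have hfs : f s ∈ bernstein K n c :=
      bernstein_monotone (Finset.le_sup (f := fun s => e (f s)) hs) (he _)
    exact Submodule.subset_span ⟨_, mul_mem_bernstein hp hfs, s, hs, rfl⟩
  refine ⟨A * (c + 1) ^ n, k₀, fun k hk => ?_⟩
  refine (Submodule.finrank_mono (hle k)).trans ?_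
  have h1 := hA (k + c)
  rw [← hk₀ (k + c) (by omega), hχ] at h1
  have h2 : Module.finrank K (inducedFiltration K n S (k + c)) ≤ A * (k + c + 1) ^ n := by
    exact_mod_cast h1
  refine h2.trans ?_
  rw [mul_assoc, ← mul_pow]
  refine Nat.mul_le_mul_left _ (Nat.pow_le_pow_left ?_ n)
  nlinarith [Nat.zero_le (c * k)]

end HolonomicGrowth

/-! ### Torsion with respect to the Euler operator -/

section TorsionClosure

variable {K : Type*} [Field K] {n : ℕ}

theorem mul_aeval_mem {J : Submodule K (D K n)} {s : D K n} (hs : ∀ p ∈ J, p * s ∈ J)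
    (b : K[X]) {p : D K n} (hp : p ∈ J) : p * Polynomial.aeval s b ∈ J := by
  induction b using Polynomial.induction_on' with
  | add b b' hb hb' => rw [map_add, mul_add]; exact J.add_mem hb hb'
  | monomial i r =>
    have hpow : p * s ^ i ∈ J := by
      induction i with
      | zero => rwa [pow_zero, mul_one]
      | succ i ih =>
        rw [pow_succ, ← mul_assoc]
        exact hs _ ih
    rw [Polynomial.aeval_monomial, ← Algebra.smul_def, mul_smul_comm]
    exact J.smul_mem r hpow

/-- For a subspace `J` that is stable under left multiplication and under right multiplication by
`s`, the left ideal of all `p` with `p b(s) ∈ J` for some nonzero `b ∈ K[X]`, the preimage of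
the `K[s]`-torsion of `D_n / J`. -/
def torsionClosure (J : Submodule K (D K n)) (s : D K n) (hJ : ∀ q, ∀ p ∈ J, q * p ∈ J)
    (hs : ∀ p ∈ J, p * s ∈ J) : Ideal (D K n) where
  carrier := {p | ∃ b : K[X], b ≠ 0 ∧ p * Polynomial.aeval s b ∈ J}
  zero_mem' := ⟨1, one_ne_zero, by simp⟩
  add_mem' := by
    rintro p q ⟨b, hb, hp⟩ ⟨c, hc, hq⟩
    refine ⟨b * c, mul_ne_zero hb hc, ?_⟩
    rw [add_mul]
    refine J.add_mem ?_ ?_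
    · rw [map_mul, ← mul_assoc]
      exact mul_aeval_mem hs c hp
    · rw [mul_comm, map_mul, ← mul_assoc]
      exact mul_aeval_mem hs b hq
  smul_mem' := by
    rintro q p ⟨b, hb, hp⟩
    refine ⟨b, hb, ?_⟩
    rw [smul_eq_mul, mul_assoc]
    exact hJ q _ hp

/-- A left ideal `J'` whose quotient is torsion-free for right multiplication by `K[s]`, with `s` of
Bernstein degree at most two, is everything if the growth of `D_n / J'` is at most `n`. -/
theorem one_mem_of_growth_le [CharZero K] (hn : 0 < n) {s : D K n} (hs2 : s ∈ bernstein K n 2)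
    (J' : Ideal (D K n)) (hs : ∀ p ∈ J', p * s ∈ J')
    (htf : ∀ (b : K[X]) (p : D K n), b ≠ 0 → p * Polynomial.aeval s b ∈ J' → p ∈ J')
    {A k₀ : ℕ} (hA : ∀ k, k₀ ≤ k →
      Module.finrank K ((bernstein K n k).map (quotientMap J')) ≤ A * (k + 1) ^ n) :
    (1 : D K n) ∈ J' := by
  by_contra h1
  let φ : Module.End K (D K n ⧸ J') :=
    (J'.mapQ J' (LinearMap.toSpanSingleton (D K n) (D K n) s) fun p hp => hs p hp).restrictScalars K
  have hφ : ∀ (b : K[X]) (p : D K n), Polynomial.aeval φ b (quotientMap J' p)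
      = quotientMap J' (p * Polynomial.aeval s b) := by
    intro b p
    induction b using Polynomial.induction_on' with
    | add b b' hb hb' =>
      rw [map_add, map_add, mul_add, map_add, LinearMap.add_apply, hb, hb']
    | monomial i r =>
      rw [Polynomial.aeval_monomial, Polynomial.aeval_monomial, ← Algebra.smul_def,
        ← Algebra.smul_def, mul_smul_comm, map_smul, LinearMap.smul_apply]
      congr 1
      induction i with
      | zero => simp
      | succ i ih =>
        rw [pow_succ', Module.End.mul_apply, ih, pow_succ, ← mul_assoc]
        rfl
  let _ : Module K[X] (D K n ⧸ J') :=
    Module.compHom _ (Polynomial.aeval φ : K[X] →ₐ[K] Module.End K (D K n ⧸ J')).toRingHom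
  have hsmul : ∀ (b : K[X]) (p : D K n),
      b • quotientMap J' p = quotientMap J' (p * Polynomial.aeval s b) := hφ
  have hsmulD : ∀ q p : D K n, q • quotientMap J' p = quotientMap J' (q * p) := fun _ _ => rfl
  have hsurj : ∀ m, ∃ p, quotientMap J' p = m := Submodule.mkQ_surjective J'
  have : IsScalarTower K K[X] (D K n ⧸ J') := by
    refine ⟨fun r b m => ?_⟩
    obtain ⟨p, rfl⟩ := hsurj m
    rw [hsmul, hsmul, map_smul, mul_smul_comm, map_smul]
  have : SMulCommClass (D K n) K[X] (D K n ⧸ J') := by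
    refine ⟨fun q b m => ?_⟩
    obtain ⟨p, rfl⟩ := hsurj m
    rw [hsmul, hsmulD, hsmulD, hsmul, mul_assoc]
  have : Module.IsTorsionFree K[X] (D K n ⧸ J') := by
    refine Module.IsTorsionFree.of_smul_eq_zero fun b m hbm => ?_
    obtain ⟨p, rfl⟩ := hsurj m
    rw [or_iff_not_imp_left]
    intro hb
    rw [hsmul, quotientMap_eq_zero] at hbm
    exact quotientMap_eq_zero.2 (htf b p hb hbm)
  refine not_growth_le_of_isTorsionFree (K := K) (v := quotientMap J' 1) hn ?_ hs2 ?_ A k₀ ?_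
  · intro b hb
    by_contra hb0
    rw [hsmul, quotientMap_eq_zero] at hb
    exact h1 (htf b 1 hb0 hb)
  · rw [hsmul, hsmulD, Polynomial.aeval_X, one_mul, mul_one]
  · intro k hk
    rw [orbitFiltration_quotientMap_one]
    exact hA k hk

theorem exists_aeval_sOp_mem_initialIdeal [CharZero K] {F : Subfield ℝ} [Algebra F K] (hn : 0 < n)
    (w : Fin n → F) (I : Ideal (D K n)) (hI : IsHolonomic K n (D K n ⧸ I)) :
    ∃ b : K[X], b ≠ 0 ∧ Polynomial.aeval (sOp K w) b ∈ initialIdeal (fun i => (w i : ℝ)) I := by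
  set J := initialIdeal (fun i => (w i : ℝ)) I with hJ
  have hJs : ∀ p ∈ J, p * sOp K w ∈ J := fun p hp => mul_sOp_mem_initialIdeal w I hp
  set J' := torsionClosure J (sOp K w) (fun q p hp => mul_mem_initialIdeal _ I q hp) hJs with hJ'
  have hle : J ≤ J'.restrictScalars K := fun p hp => ⟨1, one_ne_zero, by simpa using hp⟩
  obtain ⟨A, k₀, hA⟩ := hI.exists_finrank_orbitFiltration_le (quotientMap I 1)
  obtain ⟨b, hb, hbJ⟩ : (1 : D K n) ∈ J' := by
    refine one_mem_of_growth_le hn (s := sOp K w) (euler_mem_bernstein _) J' ?_ ?_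
      (A := A) (k₀ := k₀) ?_
    · rintro p ⟨b, hb, hp⟩
      refine ⟨b, hb, ?_⟩
      have hcomm : sOp K w * Polynomial.aeval (sOp K w) b
          = Polynomial.aeval (sOp K w) b * sOp K w := by
        have h1 := congrArg (Polynomial.aeval (sOp K w)) (mul_comm Polynomial.X b)
        simpa only [map_mul, Polynomial.aeval_X] using h1
      rw [mul_assoc, hcomm, ← mul_assoc]
      exact hJs _ hp
    · rintro b p hb ⟨c, hc, hp⟩
      refine ⟨b * c, mul_ne_zero hb hc, ?_⟩
      rwa [map_mul, ← mul_assoc]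
    · intro k hk
      refine (finrank_map_quotientMap_le _ I hle k).trans ?_
      rw [← orbitFiltration_quotientMap_one]
      exact hA k hk
  rw [one_mul] at hbJ
  exact ⟨b, hb, hbJ⟩

end TorsionClosure

end DMod

end

theorem mainTheorem2 (K : Type*) [Field K] [CharZero K] (F : Subfield ℝ) [Algebra F K] (n : ℕ)
    (w : Fin n → F) (hw : w ≠ 0) (hw0 : ∀ i, 0 ≤ w i)
    (I : Ideal (DMod.D K n)) (hI : DMod.IsHolonomic K n (DMod.D K n ⧸ I)) :
    (DMod.initialIdeal (fun i => (w i : ℝ)) I ⊓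
        Subalgebra.toSubmodule (Algebra.adjoin K {DMod.sOp K w}) ≠ ⊥) ∧
      DMod.globalBFunction w I ≠ 0 := by
  obtain ⟨i, hi⟩ := Function.ne_iff.1 hw
  obtain ⟨b, hb, hbI⟩ := DMod.exists_aeval_sOp_mem_initialIdeal (K := K) (Fin.pos i) w I hI
  constructor
  · refine (Submodule.ne_bot_iff _).2 ⟨_, ⟨hbI, Polynomial.aeval_mem_adjoin_singleton K _⟩, ?_⟩
    refine DMod.aeval_euler_ne_zero (fun h => hi ?_) hb
    exact (map_eq_zero (algebraMap F K)).1 (congrFun h i)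
  · intro h
    have h1 := (DMod.globalBFunction_dvd_iff w I b).2 hbI
    rw [h, zero_dvd_iff] at h1
    exact hb h1
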